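/- **Setting.** A warehouse is a rectilinear grid in $[0,L]\times[0,W]$ ($L,W>0$) made of $a\ge 1$ equidistant parallel aisles of length $W$ and $b\ge 2$ equidistant cross-aisles of length $L$, with a depot $l_d$ at a point of the grid; $d$ is the shortest-path distance within the grid. A picker walks at unit speed, starts at $l_d$ at time $0$, and picks items in zero time. An instance $I$ consists of orders $o_1,\dots,o_n$ with arrival times $0\le r_1\le\dots\le r_n$; each order is a set of $k\ge1$ distinct picking locations (items) in the aisles. Orders are collected in batches of at most $c\ge1$ orders, one batch after the other, and no order is split between batches. With a *pushcart* the picker returns to the depot at the end of each batch, and the total completion time is the time of the last return; with a *robot* she starts the next batch from where she is, and the total completion time is the time of the last pick. $CIOPT(I)$ is the minimum total completion time over all partitions into batches, sequences of the batches and sequences of the items in each batch, where no item is picked before the arrival of its order, but all data are known in advance. $Reopt(I)$ is the total completion time of the following online policy, with arbitrary choices among optimal plans and among shortest paths. *Non-interventionist* (system *Pcart-N*, pushcart): whenever the picker is at the depot and new orders have arrived, she plans anew, optimally, for all orders that have arrived and have not been picked; otherwise she continues with the next batch of the current plan, or, if there is none, waits at the depot. *Interventionist* (systems *Pcart* with a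 pushcart and *Robot* with a robot): she waits at the depot for the first order; at each arrival she plans anew, optimally and from her current position, for everything that has arrived and has not been picked, where orders with an item already in the current cart must be completed in the current batch, and the other bins of the cart can be assigned freely to orders not yet commenced; she follows the plan until the next arrival and, when it is completed, waits where she is. For $\lambda>0$ let, under $\mathbb P_\lambda$, the interarrival times of orders be i.i.d. exponential with mean $1/\lambda$, and the orders $O_1,O_2,\dots$ be i.i.d. with a fixed law (arbitrary dependence within an order) and independent of the arrival times. For *Robot* assume in addition $\mathbb E[K_1]>1$, where $K_1$ is the number of picking locations of $O_1$. For fixed $t>0$ let $I(t)^{rand}$ be the instance of all orders that arrive in $[0,t]$ (for an instance without orders the ratio $Reopt/CIOPT$ is set to $1$). **Theorem.** Let $(\lambda_i)_{i\in\mathbb N}$ be an increasing sequence of positive rates with $\lambda_i\to\infty$. In each of *Pcart-N*, *Pcart* and *Robot*, $$\lim_{i\to\infty}\mathbb E_{\lambda_i}\!\left[\frac{Reopt(I(t)^{rand})}{CIOPT(I(t)^{rand})}\right]=1,$$ and for every $\varepsilon>0$ $$\lim_{i\to\infty}\mathbb P_{\lambda_i}\!\left(\frac{Reopt(I(t)^{rand})}{CIOPT(I(t)^{rand})}\ge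 1+\varepsilon\right)=0 .$$ -/

import Mathlib

open MeasureTheory ProbabilityTheory Filter Topology
open scoped ENNReal

noncomputable section

namespace OOBSRP

/-! ### The warehouse -/

/-- Infrastructure parameters: length `L` (extent of the cross-aisles), width `W` (extent of the
aisles), `a ≥ 1` equidistant parallel aisles, `b ≥ 2` equidistant cross-aisles, the depot (a point
of the grid) and the batching capacity `c ≥ 1`. -/
structure Warehouse where
  L : ℝ
  W : ℝ
  a : ℕ
  b : ℕ
  c : ℕ
  L_pos : 0 < L
  W_pos : 0 < W
  one_le_a : 1 ≤ a
  two_le_b : 2 ≤ b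
  one_le_c : 1 ≤ c
  depotLoc : ℝ × ℝ
  depot_mem : depotLoc.1 ∈ Set.Icc 0 L ∧ depotLoc.2 ∈ Set.Icc 0 W ∧
    ((∃ i : ℕ, i < a ∧ depotLoc.1 = i * (L / ((a : ℝ) - 1))) ∨
      (∃ j : ℕ, j < b ∧ depotLoc.2 = j * (W / ((b : ℝ) - 1))))

namespace Warehouse

variable (w : Warehouse)

/-- `p` lies on one of the `a` aisles, at horizontal positions `0, L/(a-1), …, L`
(a single aisle is at position `0`). -/
def OnAisle (p : ℝ × ℝ) : Prop :=
  p.1 ∈ Set.Icc 0 w.L ∧ p.2 ∈ Set.Icc 0 w.W ∧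
    ∃ i : ℕ, i < w.a ∧ p.1 = i * (w.L / ((w.a : ℝ) - 1))

/-- `p` lies on one of the `b` cross-aisles, at vertical positions `0, W/(b-1), …, W`. -/
def OnCrossAisle (p : ℝ × ℝ) : Prop :=
  p.1 ∈ Set.Icc 0 w.L ∧ p.2 ∈ Set.Icc 0 w.W ∧
    ∃ j : ℕ, j < w.b ∧ p.2 = j * (w.W / ((w.b : ℝ) - 1))

/-- The region in which the picker can walk. -/
def grid : Set (ℝ × ℝ) := {p | w.OnAisle p ∨ w.OnCrossAisle p}

/-- Positions of the picker. -/
abbrev Pt : Type := {p : ℝ × ℝ // p ∈ w.grid}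

def depot : w.Pt :=
  ⟨w.depotLoc, by
    obtain ⟨h1, h2, h | h⟩ := w.depot_mem
    · exact Or.inl ⟨h1, h2, h⟩
    · exact Or.inr ⟨h1, h2, h⟩⟩

/-- `GridPath p q ℓ`: there is a polygonal path inside the grid from `p` to `q` of length `ℓ`
(every segment inside the grid is axis-parallel). -/
inductive GridPath : w.Pt → w.Pt → ℝ → Prop
  | refl (p : w.Pt) : GridPath p p 0
  | step {p q : w.Pt} {l : ℝ} (r : w.Pt) (h : GridPath p q l)
      (hseg : segment ℝ q.1 r.1 ⊆ w.grid) :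
      GridPath p r (l + (|q.1.1 - r.1.1| + |q.1.2 - r.1.2|))

/-- Walking distance (equivalently, walking time at unit speed) within the grid. -/
def d (p q : w.Pt) : ℝ := sInf {l | w.GridPath p q l}

/-- A customer order: a number `k ≥ 1` together with `k` distinct picking locations, all of them
in aisles. -/
abbrev CustomerOrder : Type :=
  {o : (Σ k : ℕ, (Fin k → w.Pt)) //
    1 ≤ o.1 ∧ Function.Injective o.2 ∧ ∀ i, w.OnAisle (o.2 i).1}

end Warehouse

/-- The number of picking locations of an order. -/
def Warehouse.CustomerOrder.size {w : Warehouse} (o : w.CustomerOrder) : ℕ := o.1.1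

/-- The three picking systems: pushcart with non-interventionist reoptimization, pushcart with
interventionist reoptimization, robot with interventionist reoptimization. -/
inductive PickingSystem
  | pcartN
  | pcart
  | robot

/-! ### Instances, plans and the complete-information optimum -/

/-- `n` orders with their arrival times (meant to be nonnegative and nondecreasing). -/
structure Instance (w : Warehouse) where
  n : ℕ
  order : Fin n → w.CustomerOrder
  arrival : Fin n → ℝ

variable {w : Warehouse}

namespace Instance

variable (I : Instance w)

/-- The items of an instance: `⟨j, i⟩` is the `i`-th item of order `j`. -/
abbrev Item : Type := Σ j : Fin I.n, Fin (I.order j).1.1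

def loc (x : I.Item) : w.Pt := (I.order x.1).1.2 x.2

/-- A plan: the sequence of batches, each given by the sequence in which its items are picked. -/
abbrev Plan : Type := List (List I.Item)

/-- The situation of the picker: her position, the items picked so far, and the orders that occupy
bins of the current cart (i.e. that have an item picked in the current, not yet finished batch). -/
structure State where
  pos : w.Pt
  picked : Finset I.Item
  cart : Finset (Fin I.n)

/-- At the depot, with nothing picked. -/
def init : I.State := ⟨w.depot, ∅, ∅⟩

/-- The orders that have arrived up to time `τ`. -/
def arrived (τ : ℝ) : Finset (Fin I.n) := Finset.univ.filter fun j => I.arrival j ≤ τ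

/-- The set of orders of a batch. -/
def ordersOf (B : List I.Item) : Finset (Fin I.n) := (B.map Sigma.fst).toFinset

/-- `P` is a feasible plan for collecting what remains of the orders in `A` from state `s`.
If the cart holds commenced orders, then the first batch of `P` is the continuation of the current
batch (possibly without further items). -/
structure Feasible (s : I.State) (A : Finset (Fin I.n)) (P : I.Plan) : Prop where
  /-- every remaining item is picked, exactly once -/
  nodup : P.flatten.Nodup
  complete : ∀ x : I.Item, x ∈ P.flatten ↔ x.1 ∈ A ∧ x ∉ s.picked
  /-- orders are not split between batches -/
  unsplit : ∀ B ∈ P, ∀ x ∈ B, ∀ y ∈ P.flatten, y.1 = x.1 → y ∈ B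
  /-- commenced orders are completed in the current batch -/
  commenced : ∀ x ∈ P.flatten, x.1 ∈ s.cart → x ∈ P.headD []
  continues : s.cart.Nonempty → P ≠ []
  /-- a batch contains at most `c` orders, including those already in the cart -/
  capacity_head : (s.cart ∪ I.ordersOf (P.headD [])).card ≤ w.c
  capacity_tail : ∀ B ∈ P.tail, (I.ordersOf B).card ≤ w.c
  /-- there are no void batches -/
  nonempty_head : s.cart = ∅ → ∀ B ∈ P, B ≠ []
  nonempty_tail : ∀ B ∈ P.tail, B ≠ []

/-- The elementary tasks of the picker: pick an item, or conclude the batch. -/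
inductive Action
  | pick (x : I.Item)
  | unload

/-- The actions of a batch: its picks, then its conclusion. -/
def batchActions (B : List I.Item) : List I.Action := B.map Action.pick ++ [Action.unload]

def actions (P : I.Plan) : List I.Action := P.flatMap I.batchActions

variable {I}

/-- The position to which an action takes the picker from `p`: a pushcart is brought to the depot
at the end of a batch, whereas a robot drives there without the picker. -/
def target (sys : PickingSystem) (p : w.Pt) : I.Action → w.Pt
  | .pick x => I.loc x
  | .unload =>
    match sys with
    | .pcartN => w.depot
    | .pcart => w.depot
    | .robot => p

/-- The state after an action. -/
def perform (sys : PickingSystem) (s : I.State) : I.Action → I.State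
  | .pick x => ⟨I.loc x, insert x s.picked, insert x.1 s.cart⟩
  | .unload => ⟨target (I := I) sys s.pos .unload, s.picked, ∅⟩

/-- The time at which a sequence of actions, started in `p` at time `τ`, is completed, if every
item is picked as early as possible, but not before the arrival of its order. -/
def completion (sys : PickingSystem) : w.Pt → ℝ → List I.Action → ℝ
  | _, τ, [] => τ
  | p, τ, .pick x :: l =>
    completion sys (I.loc x) (max (τ + w.d p (I.loc x)) (I.arrival x.1)) l
  | p, τ, .unload :: l =>
    completion sys (target (I := I) sys p .unload)
      (τ + w.d p (target (I := I) sys p .unload)) l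

variable (I)

/-- The complete-information optimum: the least completion time of a plan for all orders that
starts at the depot at time `0`. -/
def CIOPT (sys : PickingSystem) : ℝ :=
  sInf {v | ∃ P : I.Plan, I.Feasible I.init Finset.univ P ∧
    v = completion sys w.depot 0 (I.actions P)}

/-! ### Reoptimization -/

/-- `P` is an optimal plan for what remains of the orders in `A`, from state `s` at time `τ`. -/
def OptimalPlan (sys : PickingSystem) (s : I.State) (τ : ℝ) (A : Finset (Fin I.n))
    (P : I.Plan) : Prop :=
  I.Feasible s A P ∧ ∀ Q : I.Plan, I.Feasible s A Q →
    completion sys s.pos τ (I.actions P) ≤ completion sys s.pos τ (I.actions Q)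

/-- `RunUntil sys T s τ l s'`: if the picker in state `s` at time `τ` carries out the actions `l`
(on orders which have already arrived), then `s'` is a possible state at time `T`. If she is on
her way at time `T`, then her position is a point at the right distance on a shortest path. -/
inductive RunUntil (sys : PickingSystem) (T : ℝ) :
    I.State → ℝ → List I.Action → I.State → Prop
  | idle (s : I.State) (τ : ℝ) : RunUntil sys T s τ [] s
  | act {s s' : I.State} {τ : ℝ} {α : I.Action} {l : List I.Action}
      (h : τ + w.d s.pos (target sys s.pos α) ≤ T)
      (hrun : RunUntil sys T (perform sys s α) (τ + w.d s.pos (target sys s.pos α)) l s') :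
      RunUntil sys T s τ (α :: l) s'
  | walking {s : I.State} {τ : ℝ} {α : I.Action} {l : List I.Action} (q : w.Pt)
      (h : T < τ + w.d s.pos (target sys s.pos α))
      (hq : w.d s.pos q = T - τ)
      (hq' : w.d q (target sys s.pos α) = w.d s.pos (target sys s.pos α) - (T - τ)) :
      RunUntil sys T s τ (α :: l) ⟨q, s.picked, s.cart⟩

/-- `V` is a possible result of interventionist reoptimization: the picker waits at the depot for
the first order; at the arrival of each order an optimal plan for the orders that have arrived is
chosen, and it is followed until the next arrival (after the last arrival, to its end). -/
def InterventionistResult (sys : PickingSystem) (V : ℝ) : Prop :=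
  (I.n = 0 → V = 0) ∧
  ∃ (s : Fin I.n → I.State) (P : Fin I.n → I.Plan),
    (∀ j : Fin I.n, (j : ℕ) = 0 → s j = I.init) ∧
    (∀ j, I.OptimalPlan sys (s j) (I.arrival j) (I.arrived (I.arrival j)) (P j)) ∧
    (∀ j k : Fin I.n, (k : ℕ) = j + 1 →
      I.RunUntil sys (I.arrival k) (s j) (I.arrival j) (I.actions (P j)) (s k)) ∧
    (∀ j : Fin I.n, (j : ℕ) + 1 = I.n →
      V = completion sys (s j).pos (I.arrival j) (I.actions (P j)))

/-- `NonInterventionistRun τ A D P V`: if at time `τ` the picker is at the depot with an empty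
pushcart, the items `D` have been picked, the last (re)optimization has taken into account the
orders `A`, and `P` is what remains of its plan, then `V` is a possible completion time of
non-interventionist reoptimization. -/
inductive NonInterventionistRun :
    ℝ → Finset (Fin I.n) → Finset I.Item → I.Plan → ℝ → Prop
  /-- new orders have arrived: reoptimize -/
  | replan {τ : ℝ} {A : Finset (Fin I.n)} {D : Finset I.Item} {P : I.Plan} {V : ℝ} (P' : I.Plan)
      (hnew : I.arrived τ ≠ A)
      (hopt : I.OptimalPlan .pcartN ⟨w.depot, D, ∅⟩ τ (I.arrived τ) P')
      (hrun : NonInterventionistRun τ (I.arrived τ) D P' V) :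
      NonInterventionistRun τ A D P V
  /-- no new orders: collect the next batch of the plan -/
  | batch {τ : ℝ} {A : Finset (Fin I.n)} {D : Finset I.Item} {B : List I.Item} {P : I.Plan} {V : ℝ}
      (hold : I.arrived τ = A)
      (hrun : NonInterventionistRun (completion .pcartN w.depot τ (I.batchActions B)) A
        (D ∪ B.toFinset) P V) :
      NonInterventionistRun τ A D (B :: P) V
  /-- all available orders are completed: wait for the next arrival -/
  | wait {τ : ℝ} {A : Finset (Fin I.n)} {D : Finset I.Item} {V : ℝ} (j : Fin I.n)
      (hold : I.arrived τ = A) (hj : j ∉ A) (hmin : ∀ k, k ∉ A → I.arrival j ≤ I.arrival k)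
      (hrun : NonInterventionistRun (I.arrival j) A D [] V) :
      NonInterventionistRun τ A D [] V
  /-- all orders are completed -/
  | finish {τ : ℝ} {D : Finset I.Item} (hall : I.arrived τ = Finset.univ) :
      NonInterventionistRun τ Finset.univ D [] τ

/-- `V` is a total completion time that Reopt can produce on `I` in the given picking system, for
some choice among optimal plans and among shortest paths. -/
def IsReoptResult (V : ℝ) : PickingSystem → Prop
  | .pcartN => I.NonInterventionistRun 0 ∅ ∅ [] V
  | .pcart => I.InterventionistResult .pcart V
  | .robot => I.InterventionistResult .robot V

/-- The optimality ratio of a result `V` on `I`, with value `1` on the instance without orders. -/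
def ratio (sys : PickingSystem) (V : ℝ) : ℝ := if I.n = 0 then 1 else V / I.CIOPT sys

end Instance

/-! ### Poisson arrivals -/

/-- The arrival time of the `j`-th order, for inter-arrival times `X`. -/
def arrivalTime (X : ℕ → ℝ) (j : ℕ) : ℝ := ∑ i ∈ Finset.range (j + 1), X i

/-- The number of arrivals in `[0, t]`. -/
def numArrivals (X : ℕ → ℝ) (t : ℝ) : ℕ := {j : ℕ | arrivalTime X j ≤ t}.ncard

/-- The instance that consists of the orders arriving in `[0, t]`. -/
def windowInstance (X : ℕ → ℝ) (O : ℕ → w.CustomerOrder) (t : ℝ) : Instance w where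
  n := numArrivals X t
  order j := O j
  arrival j := arrivalTime X j

/-- The random instance that consists of the orders arriving in `[0, t]`. -/
def randomInstance {Ω : Type*} (X : ℕ → Ω → ℝ) (O : ℕ → Ω → w.CustomerOrder) (t : ℝ) (ω : Ω) :
    Instance w :=
  windowInstance (fun j => X j ω) (fun j => O j ω) t

/-- The stochastic model: i.i.d. exponential inter-arrival times with rate `lam` (so that arrivals
form a homogeneous Poisson process) and, independently of them, i.i.d. orders with law `ν`. -/
structure PoissonModel {Ω : Type*} [MeasurableSpace Ω] (P : Measure Ω) (lam : ℝ)
    (ν : Measure w.CustomerOrder) (X : ℕ → Ω → ℝ) (O : ℕ → Ω → w.CustomerOrder) : Prop where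
  measurable_X : ∀ j, Measurable (X j)
  measurable_O : ∀ j, Measurable (O j)
  law_X : ∀ j, P.map (X j) = expMeasure lam
  law_O : ∀ j, P.map (O j) = ν
  indep_X : iIndepFun X P
  indep_O : iIndepFun O P
  indep : IndepFun (fun ω j => X j ω) (fun ω j => O j ω) P

end OOBSRP

end

noncomputable section

namespace OOBSRP

/-! ### The walking distance -/

namespace Warehouse

variable {w : Warehouse}

/-! On every sample path Reopt loses at most a constant against the offline optimum, whereas the
optimum becomes large, with high probability, when many orders arrive. Put K = `tourBound` + `diam`.
Any finite set of items in the aisles can be toured within `tourBound`, however many there are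
(`exists_perm_walk_le`). Hence at the last arrival, at a time at most t, an interventionist picker
can finish her commenced orders and be back at the depot within K, and then carry out what is left
of any offline plan. Everything has arrived, so she never waits, and omitting stops only shortens a
walk (`walk_sublist`). As her actual plan is optimal, Reopt ≤ CIOPT + t + K. In Pcart-N the batch
under way at the last arrival takes at most K by an exchange argument (`OptimalPlan.walk_head_le`),
with the same conclusion.

A cruder count gives Reopt ≤ 5 CIOPT. Conversely, what Reopt has done can be put in front of any
plan for the rest (`Extendable`), so Reopt ≥ CIOPT. These comparisons are collected in
`ComparesToPlans`.

A batch with a δ-far order (`Far`) costs at least δ of walking and holds at most c orders. So N far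
orders force CIOPT ≥ δN/c, and the ratio is at most 1 + c(t + K)/(δN)
(`IsReoptResult.ratio_bounds`).

The probabilistic part is a dichotomy (`exists_far_or_ae_depot`). Either δ-far orders have positive
probability for some δ > 0, or a pushcart is used and almost surely all items lie at the depot,
where the ratio is exactly 1. In the first case fix N that makes the bound less than 1 + ε, then a
number of orders that contains N far ones with high probability, and only then let the rate grow
until all of these arrive by time t with high probability. This is convergence in probability;
expectations follow because the ratio lies in [1, 5]. -/

/-- The rectilinear distance in the plane. -/
def rect (p q : w.Pt) : ℝ := |p.1.1 - q.1.1| + |p.1.2 - q.1.2|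

lemma rect_nonneg (p q : w.Pt) : 0 ≤ rect p q := by unfold rect; positivity

lemma rect_comm (p q : w.Pt) : rect p q = rect q p := by
  simp only [rect, abs_sub_comm]

lemma rect_triangle (p q r : w.Pt) : rect p r ≤ rect p q + rect q r := by
  have h1 := abs_sub_le p.1.1 q.1.1 r.1.1
  have h2 := abs_sub_le p.1.2 q.1.2 r.1.2
  simp only [rect]; linarith

lemma eq_of_rect_eq_zero {p q : w.Pt} (h : rect p q = 0) : p = q := by
  have h1 := abs_nonneg (p.1.1 - q.1.1)
  have h2 := abs_nonneg (p.1.2 - q.1.2)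
  simp only [rect] at h
  have h3 : |p.1.1 - q.1.1| = 0 := by linarith
  have h4 : |p.1.2 - q.1.2| = 0 := by linarith
  exact Subtype.ext (Prod.ext (sub_eq_zero.1 (abs_eq_zero.1 h3)) (sub_eq_zero.1 (abs_eq_zero.1 h4)))

lemma GridPath.rect_le {p q : w.Pt} {l : ℝ} (h : w.GridPath p q l) : rect p q ≤ l := by
  induction h with
  | refl => simp [rect]
  | step r h hseg ih => exact (rect_triangle _ _ _).trans (add_le_add_left ih _)

lemma GridPath.trans {p q r : w.Pt} {l l' : ℝ} (h : w.GridPath p q l) (h' : w.GridPath q r l') :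
    w.GridPath p r (l + l') := by
  induction h' with
  | refl => simpa using h
  | step r h' hseg ih => rw [← add_assoc]; exact GridPath.step r ih hseg

lemma GridPath.single {p q : w.Pt} (hseg : segment ℝ p.1 q.1 ⊆ w.grid) :
    w.GridPath p q (rect p q) := by
  simpa [rect] using GridPath.step q (GridPath.refl p) hseg

lemma GridPath.symm {p q : w.Pt} {l : ℝ} (h : w.GridPath p q l) : w.GridPath q p l := by
  induction h with
  | refl => exact GridPath.refl _
  | @step q' l' r h hseg ih =>
    rw [segment_symm] at hseg
    have := (GridPath.single hseg).trans ih
    rwa [rect_comm, add_comm] at this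

lemma bddBelow_gridPath (p q : w.Pt) : BddBelow {l | w.GridPath p q l} :=
  ⟨rect p q, fun _ h => GridPath.rect_le h⟩

lemma GridPath.d_le {p q : w.Pt} {l : ℝ} (h : w.GridPath p q l) : w.d p q ≤ l :=
  csInf_le (bddBelow_gridPath p q) h

lemma vertical_segment {x y y' : ℝ} (h : w.OnAisle (x, y)) (h' : w.OnAisle (x, y')) :
    segment ℝ (x, y) (x, y') ⊆ w.grid := by
  rw [← Prod.image_mk_segment_right]
  rintro _ ⟨z, hz, rfl⟩
  exact Or.inl ⟨h.1, (convex_Icc (0 : ℝ) w.W).segment_subset h.2.1 h'.2.1 hz, h.2.2⟩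

lemma horizontal_segment {x x' y : ℝ} (h : w.OnCrossAisle (x, y)) (h' : w.OnCrossAisle (x', y)) :
    segment ℝ (x, y) (x', y) ⊆ w.grid := by
  rw [← Prod.image_mk_segment_left]
  rintro _ ⟨z, hz, rfl⟩
  exact Or.inr ⟨(convex_Icc (0 : ℝ) w.L).segment_subset h.1 h'.1 hz, h.2.1, h.2.2⟩

lemma onAisle_zero_left {y : ℝ} (hy : y ∈ Set.Icc 0 w.W) : w.OnAisle (0, y) :=
  ⟨⟨le_rfl, w.L_pos.le⟩, hy, 0, w.one_le_a, by simp⟩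

lemma onCrossAisle_zero_right {x : ℝ} (hx : x ∈ Set.Icc 0 w.L) : w.OnCrossAisle (x, 0) :=
  ⟨hx, ⟨le_rfl, w.W_pos.le⟩, 0, by have := w.two_le_b; omega, by simp⟩

/-- The corner `(0, 0)` of the grid. -/
def corner (w : Warehouse) : w.Pt :=
  ⟨(0, 0), Or.inl (onAisle_zero_left ⟨le_rfl, w.W_pos.le⟩)⟩

lemma rect_corner_le (p : w.Pt) : rect p w.corner ≤ w.L + w.W := by
  have h : p.1.1 ∈ Set.Icc 0 w.L ∧ p.1.2 ∈ Set.Icc 0 w.W := by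
    obtain h | h := p.2 <;> exact ⟨h.1, h.2.1⟩
  simp only [rect, corner, sub_zero, abs_of_nonneg h.1.1, abs_of_nonneg h.2.1]
  linarith [h.1.2, h.2.2]

/-- From an aisle go down to the cross-aisle at height 0 and along it to the corner; from a
cross-aisle go to the aisle at position 0 and down. Both routes are monotone, so they are as short
as the plane allows. Through the corner any two points of the grid are connected. -/
lemma gridPath_corner (p : w.Pt) : w.GridPath p w.corner (rect p w.corner) := by
  obtain ⟨⟨x, y⟩, hp⟩ := p
  obtain h | h := hp
  · have h0 : w.OnAisle (x, 0) := ⟨h.1, ⟨le_rfl, w.W_pos.le⟩, h.2.2⟩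
    have h1 : w.GridPath ⟨(x, y), Or.inl h⟩ ⟨(x, 0), Or.inl h0⟩ _ :=
      GridPath.single (vertical_segment h h0)
    have h2 : w.GridPath ⟨(x, 0), Or.inl h0⟩ w.corner _ :=
      GridPath.single (horizontal_segment (onCrossAisle_zero_right h.1)
        (onCrossAisle_zero_right ⟨le_rfl, w.L_pos.le⟩))
    convert h1.trans h2 using 1
    simp [rect, corner, add_comm]
  · have h0 : w.OnCrossAisle (0, y) := ⟨⟨le_rfl, w.L_pos.le⟩, h.2.1, h.2.2⟩
    have h1 : w.GridPath ⟨(x, y), Or.inr h⟩ ⟨(0, y), Or.inr h0⟩ _ :=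
      GridPath.single (horizontal_segment h h0)
    have h2 : w.GridPath ⟨(0, y), Or.inr h0⟩ w.corner _ :=
      GridPath.single (vertical_segment (onAisle_zero_left h.2.1)
        (onAisle_zero_left ⟨le_rfl, w.W_pos.le⟩))
    convert h1.trans h2 using 1
    simp [rect, corner]

lemma nonempty_gridPath (p q : w.Pt) : {l | w.GridPath p q l}.Nonempty :=
  ⟨_, (gridPath_corner p).trans (gridPath_corner q).symm⟩

/-- An upper bound for the walking distances. -/
def diam (w : Warehouse) : ℝ := 2 * (w.L + w.W)

lemma diam_nonneg : 0 ≤ w.diam := by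
  have := w.L_pos; have := w.W_pos; unfold diam; positivity

lemma d_le_diam (p q : w.Pt) : w.d p q ≤ w.diam := by
  refine ((gridPath_corner p).trans (gridPath_corner q).symm).d_le.trans ?_
  have := rect_corner_le p; have := rect_corner_le q
  unfold diam; linarith

lemma rect_le_d (p q : w.Pt) : rect p q ≤ w.d p q :=
  le_csInf (nonempty_gridPath p q) fun _ h => GridPath.rect_le h

lemma d_nonneg (p q : w.Pt) : 0 ≤ w.d p q := (rect_nonneg p q).trans (rect_le_d p q)

@[simp] lemma d_self (p : w.Pt) : w.d p p = 0 :=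
  le_antisymm (GridPath.refl p).d_le (d_nonneg p p)

lemma d_comm (p q : w.Pt) : w.d p q = w.d q p := by
  unfold d; congr 1; ext l; exact ⟨GridPath.symm, GridPath.symm⟩

lemma d_triangle (p q r : w.Pt) : w.d p r ≤ w.d p q + w.d q r := by
  rw [← sub_le_iff_le_add]
  refine le_csInf (nonempty_gridPath p q) fun l hl => ?_
  rw [sub_le_iff_le_add', ← sub_le_iff_le_add]
  refine le_csInf (nonempty_gridPath q r) fun l' hl' => ?_
  rw [sub_le_iff_le_add']
  exact (GridPath.trans hl hl').d_le

lemma d_le_of_same_aisle {p q : w.Pt} (hp : w.OnAisle p.1) (hq : w.OnAisle q.1)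
    (h : p.1.1 = q.1.1) : w.d p q ≤ |p.1.2 - q.1.2| := by
  obtain ⟨⟨x, y⟩, hp'⟩ := p
  obtain ⟨⟨x', y'⟩, hq'⟩ := q
  obtain rfl : x = x' := h
  simpa [rect] using (GridPath.single (p := ⟨(x, y), hp'⟩) (q := ⟨(x, y'), hq'⟩)
    (vertical_segment hp hq)).d_le

/-! ### Walks through a list of points -/

/-- The length of a walk that starts in a point and visits the points of a list in order. -/
def walk : w.Pt → List w.Pt → ℝ
  | _, [] => 0
  | p, q :: l => w.d p q + walk q l

@[simp] lemma walk_nil (p : w.Pt) : walk p [] = 0 := rfl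

@[simp] lemma walk_cons (p q : w.Pt) (l : List w.Pt) : walk p (q :: l) = w.d p q + walk q l := rfl

lemma walk_nonneg (p : w.Pt) (l : List w.Pt) : 0 ≤ walk p l := by
  induction l generalizing p with
  | nil => simp
  | cons q l ih => exact add_nonneg (d_nonneg _ _) (ih q)

lemma walk_le_d_add_walk (p q : w.Pt) (l : List w.Pt) : walk p l ≤ w.d p q + walk q l := by
  cases l with
  | nil => simpa using d_nonneg p q
  | cons r l => simp only [walk_cons]; linarith [d_triangle p q r]

lemma walk_append (p : w.Pt) (l l' : List w.Pt) :
    walk p (l ++ l') = walk p l + walk (l.getLastD p) l' := by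
  induction l generalizing p with
  | nil => simp
  | cons q l ih =>
    simp only [List.cons_append, walk_cons, ih, List.getLastD_cons]
    ring

lemma d_getLastD_le_walk (p : w.Pt) (l : List w.Pt) : w.d p (l.getLastD p) ≤ walk p l := by
  induction l generalizing p with
  | nil => simp
  | cons q l ih =>
    simp only [walk_cons, List.getLastD_cons]
    linarith [d_triangle p q (l.getLastD q), ih q]

/-- Skipping a stop is a shortcut by the triangle inequality. This is how every restricted plan is
compared with the plan it comes from. -/
lemma walk_sublist {l l' : List w.Pt} (h : l.Sublist l') (p : w.Pt) : walk p l ≤ walk p l' := by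
  induction h generalizing p with
  | slnil => exact le_rfl
  | cons q h ih =>
    rw [walk_cons]
    exact (walk_le_d_add_walk p q _).trans (add_le_add_right (ih q) _)
  | cons_cons q h ih => simpa using ih q

lemma walk_append_singleton_le (p q : w.Pt) (l : List w.Pt) :
    walk p (l ++ [q]) ≤ walk p l + w.diam := by
  rw [walk_append]; simpa using d_le_diam _ _

/-! ### Picking tours of bounded length -/

/-- Reaching the lowest item costs at most `diam`; the rest is one upward sweep, which telescopes to
at most `W`. -/
lemma walk_sorted_aisle {α : Type*} (f : α → w.Pt) (l : List α) (x : ℝ)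
    (hl : ∀ z ∈ l, w.OnAisle (f z).1 ∧ (f z).1.1 = x)
    (hs : l.Pairwise fun y z => (f y).1.2 ≤ (f z).1.2) (p : w.Pt) :
    walk p (l.map f) ≤ w.diam + w.W := by
  -- For the induction the bound is the part of the aisle that still lies above the current item.
  have key : ∀ (l : List α) (y : α), (∀ z ∈ y :: l, w.OnAisle (f z).1 ∧ (f z).1.1 = x) →
      (y :: l).Pairwise (fun y z => (f y).1.2 ≤ (f z).1.2) →
      walk (f y) (l.map f) ≤ w.W - (f y).1.2 := by
    intro l
    induction l with
    | nil =>
      intro y hy _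
      simpa using (hy y (by simp)).1.2.1.2
    | cons z l ih =>
      intro y hy hs
      have h1 := ih z (fun u hu => hy u (List.mem_cons_of_mem _ hu)) (List.pairwise_cons.1 hs).2
      have h2 := (List.pairwise_cons.1 hs).1 z (by simp)
      have hy' := hy y (by simp)
      have hz := hy z (by simp)
      have h3 := d_le_of_same_aisle hy'.1 hz.1 (hy'.2.trans hz.2.symm)
      rw [abs_sub_comm, abs_of_nonneg (by linarith)] at h3
      simp only [List.map_cons, walk_cons]; linarith
  cases l with
  | nil => simpa using add_nonneg (diam_nonneg (w := w)) w.W_pos.le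
  | cons y l =>
    have h1 := key l y hl hs
    have h2 := (hl y (by simp)).1.2.1.1
    simp only [List.map_cons, walk_cons]
    linarith [d_le_diam p (f y)]

/-- The aisles are swept one after the other, each at a cost that ignores the number of its items.
The order of visits does not depend on the starting point `p`, so sweeps can be concatenated. -/
lemma exists_perm_walk_le_aisles {α : Type*} (f : α → w.Pt) (m : ℕ) (l : List α)
    (hl : ∀ z ∈ l, w.OnAisle (f z).1 ∧
      ∃ i : ℕ, i < m ∧ (f z).1.1 = i * (w.L / ((w.a : ℝ) - 1))) :
    ∃ l' : List α, l'.Perm l ∧ ∀ p, walk p (l'.map f) ≤ m * (w.diam + w.W) := by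
  classical
  induction m generalizing l with
  | zero =>
    cases l with
    | nil => exact ⟨[], List.Perm.refl _, by simp⟩
    | cons z l => obtain ⟨_, i, hi, _⟩ := hl z (by simp); omega
  | succ m ih =>
    let on : α → Bool := fun z => decide ((f z).1.1 = (m : ℝ) * (w.L / ((w.a : ℝ) - 1)))
    obtain ⟨l₁, hp₁, h₁⟩ := ih (l.filter fun z => !on z) (by
      intro z hz
      rw [List.mem_filter] at hz
      obtain ⟨ha, i, hi, hx⟩ := hl z hz.1
      refine ⟨ha, i, ?_, hx⟩
      have : i ≠ m := by
        rintro rfl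
        simp [on, hx] at hz
      omega)
    let r : α → α → Prop := fun y z => (f y).1.2 ≤ (f z).1.2
    have : Std.Total r := ⟨fun y z => le_total _ _⟩
    have : IsTrans α r := ⟨fun x y z h h' => le_trans (α := ℝ) h h'⟩
    let l₂ := (l.filter on).insertionSort r
    have hp₂ : l₂.Perm (l.filter on) := List.perm_insertionSort r _
    have h₂ : ∀ p, walk p (l₂.map f) ≤ w.diam + w.W := by
      refine walk_sorted_aisle f l₂ ((m : ℝ) * (w.L / ((w.a : ℝ) - 1))) (fun z hz => ?_)
        (List.pairwise_insertionSort r _)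
      have hz := hp₂.mem_iff.1 hz
      rw [List.mem_filter] at hz
      exact ⟨(hl z hz.1).1, by simpa [on] using hz.2⟩
    refine ⟨l₂ ++ l₁, (hp₂.append hp₁).trans (List.filter_append_perm on l), fun p => ?_⟩
    rw [List.map_append, walk_append]
    push_cast
    linarith [h₁ ((l₂.map f).getLastD p), h₂ p]

/-- An upper bound for the length of some tour through any finite set of picking locations. -/
def tourBound (w : Warehouse) : ℝ := w.a * (w.diam + w.W)

lemma exists_perm_walk_le {α : Type*} (f : α → w.Pt) (l : List α)
    (hl : ∀ z ∈ l, w.OnAisle (f z).1) :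
    ∃ l' : List α, l'.Perm l ∧ ∀ p, walk p (l'.map f) ≤ w.tourBound :=
  exists_perm_walk_le_aisles f w.a l fun z hz => ⟨hl z hz, (hl z hz).2.2⟩

end Warehouse

end OOBSRP

end

noncomputable section

namespace OOBSRP

variable {w : Warehouse}

namespace Instance

open Warehouse

variable {I : Instance w}

/-! ### Completion times -/

@[simp] lemma actions_nil : I.actions [] = [] := rfl

@[simp] lemma actions_cons_nil (P : I.Plan) : I.actions ([] :: P) = .unload :: I.actions P := rfl

@[simp] lemma actions_cons_cons (x : I.Item) (B : List I.Item) (P : I.Plan) :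
    I.actions ((x :: B) :: P) = .pick x :: I.actions (B :: P) := rfl

lemma actions_cons (B : List I.Item) (P : I.Plan) :
    I.actions (B :: P) = I.batchActions B ++ I.actions P := rfl

/-- The points that the picker visits in order to conclude a batch. -/
def unloadStops (w : Warehouse) : PickingSystem → List w.Pt
  | .pcartN => [w.depot]
  | .pcart => [w.depot]
  | .robot => []

/-- The points that the picker visits in order to carry out an action. -/
def stops (sys : PickingSystem) : I.Action → List w.Pt
  | .pick x => [I.loc x]
  | .unload => unloadStops w sys

/-- The points that the picker visits in order to carry out a sequence of actions. -/
def route (sys : PickingSystem) (l : List I.Action) : List w.Pt := l.flatMap (stops sys)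

@[simp] lemma route_nil (sys : PickingSystem) : route sys ([] : List I.Action) = [] := rfl

@[simp] lemma route_pick (sys : PickingSystem) (x : I.Item) (l : List I.Action) :
    route sys (.pick x :: l) = I.loc x :: route sys l := rfl

@[simp] lemma route_unload (sys : PickingSystem) (l : List I.Action) :
    route sys (.unload :: l) = unloadStops w sys ++ route sys l := rfl

lemma route_append (sys : PickingSystem) (l l' : List I.Action) :
    route sys (l ++ l') = route sys l ++ route sys l' := List.flatMap_append

lemma route_batchActions (sys : PickingSystem) (B : List I.Item) :
    route sys (I.batchActions B) = B.map I.loc ++ unloadStops w sys := by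
  simp only [batchActions, route_append]
  congr 1
  · simp only [route, List.flatMap_map, stops]
    induction B with
    | nil => rfl
    | cons x B ih => simpa using ih
  · simp

lemma target_unload (sys : PickingSystem) (p : w.Pt) :
    target (I := I) sys p .unload = (unloadStops w sys).getLastD p := by
  cases sys <;> rfl

lemma d_target_unload (sys : PickingSystem) (p : w.Pt) :
    w.d p (target (I := I) sys p .unload) = walk p (unloadStops w sys) := by
  cases sys <;> simp [target, unloadStops]

/-- Waiting for arrivals can only add to the walking time. -/
lemma add_walk_le_completion (sys : PickingSystem) (p : w.Pt) (τ : ℝ) (l : List I.Action) :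
    τ + walk p (route sys l) ≤ completion sys p τ l := by
  induction l generalizing p τ with
  | nil => simp [completion]
  | cons α l ih =>
    cases α with
    | pick x =>
      rw [route_pick, walk_cons, completion]
      refine le_trans ?_ (ih _ _)
      linarith [le_max_left (τ + w.d p (I.loc x)) (I.arrival x.1)]
    | unload =>
      rw [route_unload, walk_append, completion]
      refine le_trans ?_ (ih _ _)
      rw [d_target_unload, target_unload]
      linarith

/-- If all orders to be picked have arrived at the start, nobody waits, and comparing plans amounts
to comparing lengths of walks. -/
lemma completion_eq (sys : PickingSystem) (p : w.Pt) (τ : ℝ) (l : List I.Action)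
    (h : ∀ x, Action.pick x ∈ l → I.arrival x.1 ≤ τ) :
    completion sys p τ l = τ + walk p (route sys l) := by
  induction l generalizing p τ with
  | nil => simp [completion]
  | cons α l ih =>
    cases α with
    | pick x =>
      have hd := d_nonneg p (I.loc x)
      have hx := h x (by simp)
      rw [route_pick, walk_cons, completion, max_eq_left (by linarith), ih]
      · ring
      · intro y hy
        linarith [h y (List.mem_cons_of_mem _ hy)]
    | unload =>
      rw [route_unload, walk_append, completion, d_target_unload, target_unload, ih]
      · ring
      · intro y hy
        linarith [h y (List.mem_cons_of_mem _ hy), walk_nonneg p (unloadStops w sys)]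

lemma le_completion (sys : PickingSystem) (p : w.Pt) (τ : ℝ) (l : List I.Action) :
    τ ≤ completion sys p τ l :=
  (le_add_of_nonneg_right (walk_nonneg _ _)).trans (add_walk_le_completion sys p τ l)

lemma arrival_le_completion (sys : PickingSystem) (p : w.Pt) (τ : ℝ) (l : List I.Action)
    (x : I.Item) (hx : Action.pick x ∈ l) : I.arrival x.1 ≤ completion sys p τ l := by
  induction l generalizing p τ with
  | nil => simp at hx
  | cons α l ih =>
    rcases List.mem_cons.1 hx with rfl | hx'
    · exact (le_max_right _ _).trans (le_completion _ _ _ _)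
    · cases α <;> exact ih _ _ hx'

/-- A picker in `p` at time `τ` can first walk to `p'`, arrive there by `τ'` and imitate the other
one. -/
lemma completion_mono (sys : PickingSystem) {p p' : w.Pt} {τ τ' : ℝ} (h : τ + w.d p p' ≤ τ')
    (l : List I.Action) : completion sys p τ l ≤ completion sys p' τ' l := by
  induction l generalizing p p' τ τ' with
  | nil => simpa [completion] using (le_add_of_nonneg_right (d_nonneg p p')).trans h
  | cons α l ih =>
    have key : ∀ q, τ + w.d p q ≤ τ' + w.d p' q := fun q => by
      linarith [d_triangle p p' q]
    cases α with
    | pick x =>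
      refine ih ?_
      rw [d_self, add_zero]
      exact max_le_max (key _) le_rfl
    | unload =>
      refine ih ?_
      -- A pushcart takes both pickers to the depot; a robot leaves them where they are, so the
      -- hypothesis persists unchanged.
      cases sys <;> simp only [target, d_self, add_zero] <;> first | exact key _ | exact h

lemma completion_append (sys : PickingSystem) (p : w.Pt) (τ : ℝ) (l l' : List I.Action) :
    completion sys p τ (l ++ l') =
      completion sys ((route sys l).getLastD p) (completion sys p τ l) l' := by
  induction l generalizing p τ with
  | nil => simp [completion]
  | cons α l ih =>
    cases α with
    | pick x => simp only [List.cons_append, completion, route_pick, List.getLastD_cons, ih]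
    | unload =>
      simp only [List.cons_append, completion, route_unload, ih, target_unload]
      congr 1
      cases sys <;> simp only [unloadStops, List.cons_append, List.nil_append, List.getLastD_cons,
        List.getLastD_nil]

lemma pick_mem_actions {P : I.Plan} {x : I.Item} : Action.pick x ∈ I.actions P ↔ x ∈ P.flatten := by
  simp [actions, batchActions]

/-! ### Feasible plans -/

lemma ordersOf_cons (x : I.Item) (B : List I.Item) :
    I.ordersOf (x :: B) = insert x.1 (I.ordersOf B) := by
  simp [ordersOf]

@[simp] lemma ordersOf_nil : I.ordersOf [] = ∅ := rfl

lemma mem_ordersOf {B : List I.Item} {j : Fin I.n} :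
    j ∈ I.ordersOf B ↔ ∃ x ∈ B, x.1 = j := by
  simp [ordersOf]

lemma ordersOf_mono {B B' : List I.Item} (h : B ⊆ B') : I.ordersOf B ⊆ I.ordersOf B' := by
  intro j hj
  obtain ⟨x, hx, rfl⟩ := mem_ordersOf.1 hj
  exact mem_ordersOf.2 ⟨x, h hx, rfl⟩

/-- After a pick, the rest of a feasible plan is feasible. -/
lemma Feasible.pick {s : I.State} {A : Finset (Fin I.n)} {x : I.Item} {B : List I.Item}
    {P : I.Plan} (sys : PickingSystem) (h : I.Feasible s A ((x :: B) :: P)) :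
    I.Feasible (perform sys s (.pick x)) A (B :: P) := by
  have hnd := h.nodup
  rw [List.flatten_cons, List.cons_append, List.nodup_cons] at hnd
  have hcons : ∀ y, y ∈ ((x :: B) :: P).flatten ↔ y = x ∨ y ∈ (B :: P).flatten := by
    intro y; simp
  have hx : x ∉ (B :: P).flatten := by simpa using hnd.1
  refine ⟨by simpa using hnd.2, fun y => ?_, fun B' hB' y hy z hz hzy => ?_, fun y hy hys => ?_,
    fun _ => by simp, ?_, h.capacity_tail, fun hc => ?_, h.nonempty_tail⟩
  · have h1 := h.complete y
    rw [hcons] at h1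
    simp only [perform, Finset.mem_insert, not_or]
    constructor
    · intro hy
      have h2 := h1.1 (Or.inr hy)
      exact ⟨h2.1, fun e => hx (e ▸ hy), h2.2⟩
    · rintro ⟨h2, h3, h4⟩
      exact (h1.2 ⟨h2, h4⟩).resolve_left h3
  · have hz' : z ∈ ((x :: B) :: P).flatten := (hcons z).2 (Or.inr hz)
    rcases List.mem_cons.1 hB' with rfl | hB''
    · have := h.unsplit (x :: B') (by simp) y (by simp [hy]) z hz' hzy
      rcases List.mem_cons.1 this with rfl | h2
      · exact absurd hz hx
      · exact h2
    · exact h.unsplit B' (by simp [hB'']) y hy z hz' hzy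
  · have hy' : y ∈ ((x :: B) :: P).flatten := (hcons y).2 (Or.inr hy)
    have : y ∈ x :: B := by
      rcases Finset.mem_insert.1 hys with e | hys
      · exact h.unsplit (x :: B) (by simp) x (by simp) y hy' e
      · exact h.commenced y hy' hys
    rcases List.mem_cons.1 this with rfl | h2
    · exact absurd hy hx
    · exact h2
  · have := h.capacity_head
    simpa [perform, ordersOf_cons] using this
  · simp [perform] at hc

/-- A plan that is feasible after a pick is feasible before it, with the pick put in front. -/
lemma Feasible.of_pick {s : I.State} {A : Finset (Fin I.n)} {x : I.Item} {P : I.Plan}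
    {sys : PickingSystem} (h : I.Feasible (perform sys s (.pick x)) A P) (hx : x ∉ s.picked)
    (hA : x.1 ∈ A) :
    ∃ B P', P = B :: P' ∧ I.Feasible s A ((x :: B) :: P') := by
  obtain ⟨B, P, rfl⟩ := List.exists_cons_of_ne_nil (h.continues (by simp [perform]))
  refine ⟨B, P, rfl, ?_⟩
  have hcons : ∀ y, y ∈ ((x :: B) :: P).flatten ↔ y = x ∨ y ∈ (B :: P).flatten := by
    intro y; simp
  have hx' : x ∉ (B :: P).flatten := fun h' => by
    have := ((h.complete x).1 h').2
    simp [perform] at this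
  have hnd := h.nodup
  rw [List.flatten_cons, List.nodup_append] at hnd
  have hord : ∀ y ∈ (B :: P).flatten, y.1 = x.1 → y ∈ B := fun y hy e =>
    h.commenced y hy (by simp [perform, e])
  refine ⟨?_, fun y => ?_, fun B' hB' y hy z hz hzy => ?_, fun y hy hys => ?_,
    fun _ => by simp, ?_, h.capacity_tail, fun _ B' hB' => ?_, h.nonempty_tail⟩
  · rw [List.flatten_cons, List.cons_append, List.nodup_cons]
    exact ⟨by simpa using hx', by simpa using h.nodup⟩
  · rw [hcons, h.complete y]
    simp only [perform, Finset.mem_insert, not_or]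
    constructor
    · rintro (rfl | ⟨h1, _, h2⟩)
      exacts [⟨hA, hx⟩, ⟨h1, h2⟩]
    · rintro ⟨h1, h2⟩
      by_cases e : y = x
      · exact Or.inl e
      · exact Or.inr ⟨h1, e, h2⟩
  · rw [hcons] at hz
    rcases List.mem_cons.1 hB' with rfl | hB''
    · rcases hz with rfl | hz
      · simp
      · rcases List.mem_cons.1 hy with rfl | hy
        · exact List.mem_cons_of_mem _ (hord z hz hzy)
        · exact List.mem_cons_of_mem _ (h.unsplit B (by simp) y hy z hz hzy)
    · rcases hz with rfl | hz
      · have hyP : y ∈ P.flatten := List.mem_flatten.2 ⟨B', hB'', hy⟩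
        exact absurd rfl (hnd.2.2 y (hord y (by simp [hyP]) hzy.symm) y hyP)
      · exact h.unsplit B' (by simp [hB'']) y hy z hz hzy
  · rcases (hcons y).1 hy with rfl | hy
    · simp
    · exact List.mem_cons_of_mem _ (h.commenced y hy (by simp [perform, hys]))
  · have := h.capacity_head
    simpa [perform, ordersOf_cons] using this
  · rcases List.mem_cons.1 hB' with rfl | hB''
    · simp
    · exact h.nonempty_tail B' hB''

/-- After the conclusion of a batch, the rest of a feasible plan is feasible. -/
lemma Feasible.unload {s : I.State} {A : Finset (Fin I.n)} {P : I.Plan} (sys : PickingSystem)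
    (h : I.Feasible s A ([] :: P)) : I.Feasible (perform sys s .unload) A P := by
  have hP : ∀ B ∈ P, (I.ordersOf B).card ≤ w.c := h.capacity_tail
  have hne : ∀ B ∈ P, B ≠ [] := h.nonempty_tail
  refine ⟨by simpa using h.nodup, fun y => by simpa [perform] using h.complete y,
    fun B hB x hx y hy => h.unsplit B (by simp [hB]) x hx y (by simpa using hy),
    fun x _ hx => by simp [perform] at hx, fun hc => by simp [perform] at hc, ?_,
    fun B hB => hP B (List.mem_of_mem_tail hB), fun _ => hne,
    fun B hB => hne B (List.mem_of_mem_tail hB)⟩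
  cases P with
  | nil => simp [perform]
  | cons B P => simpa [perform] using hP B (by simp)

/-- An empty first batch is legitimate only as the continuation of a commenced one. -/
lemma Feasible.cart_nonempty {s : I.State} {A : Finset (Fin I.n)} {P : I.Plan}
    (h : I.Feasible s A ([] :: P)) : s.cart.Nonempty := by
  by_contra hc
  exact h.nonempty_head (Finset.not_nonempty_iff_eq_empty.1 hc) [] (by simp) rfl

lemma Feasible.card_cart_le {s : I.State} {A : Finset (Fin I.n)} {P : I.Plan}
    (h : I.Feasible s A P) : s.cart.card ≤ w.c :=
  (Finset.card_le_card Finset.subset_union_left).trans h.capacity_head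

lemma Feasible.cart_complete {s : I.State} {A : Finset (Fin I.n)} {P : I.Plan}
    (h : I.Feasible s A ([] :: P)) (hA : s.cart ⊆ A) (x : I.Item) (hx : x.1 ∈ s.cart) :
    x ∈ s.picked := by
  by_contra hxp
  simpa using h.commenced x ((h.complete x).2 ⟨hA hx, hxp⟩) hx

/-- A plan that is feasible after the conclusion of a batch of complete orders is feasible before
it, with the conclusion put in front. -/
lemma Feasible.of_unload {s : I.State} {A : Finset (Fin I.n)} {P : I.Plan} {sys : PickingSystem}
    (h : I.Feasible (perform sys s .unload) A P) (hne : s.cart.Nonempty) (hc : s.cart.card ≤ w.c)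
    (hs : ∀ x : I.Item, x.1 ∈ s.cart → x ∈ s.picked) : I.Feasible s A ([] :: P) := by
  refine ⟨by simpa using h.nodup, fun y => by simpa [perform] using h.complete y,
    fun B hB x hx y hy => ?_, fun x hx hxs => ?_, fun _ => by simp, by simpa using hc, ?_,
    fun h0 => absurd h0 hne.ne_empty, h.nonempty_head rfl⟩
  · rcases List.mem_cons.1 hB with rfl | hB
    · simp at hx
    · exact h.unsplit B hB x hx y (by simpa using hy)
  · exact absurd (hs x hxs) ((h.complete x).1 (by simpa using hx)).2
  · intro B hB
    rw [List.tail_cons] at hB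
    cases P with
    | nil => simp at hB
    | cons B' P =>
      rcases List.mem_cons.1 hB with rfl | hB
      · simpa [perform] using h.capacity_head
      · exact h.capacity_tail B hB

lemma feasible_congr {s s' : I.State} {A : Finset (Fin I.n)} {P : I.Plan}
    (hp : s.picked = s'.picked) (hc : s.cart = s'.cart) (h : I.Feasible s A P) :
    I.Feasible s' A P := by
  obtain ⟨p, D, C⟩ := s
  obtain ⟨p', D', C'⟩ := s'
  obtain rfl : D = D' := hp
  obtain rfl : C = C' := hc
  exact ⟨h.1, h.2, h.3, h.4, h.5, h.6, h.7, h.8, h.9⟩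

lemma Feasible.capacity {s : I.State} {A : Finset (Fin I.n)} {P : I.Plan} (h : I.Feasible s A P)
    {B : List I.Item} (hB : B ∈ P) : (I.ordersOf B).card ≤ w.c := by
  cases P with
  | nil => simp at hB
  | cons B' P =>
    rcases List.mem_cons.1 hB with rfl | hB
    · exact (Finset.card_le_card Finset.subset_union_right).trans h.capacity_head
    · exact h.capacity_tail B hB

/-! ### Restricting a plan to the items that remain -/

/-- The items of a plan that satisfy a condition, without void batches. -/
def restrict (P : I.Plan) (p : I.Item → Bool) : I.Plan :=
  (P.map (List.filter p)).filter (fun B => !B.isEmpty)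

lemma flatten_restrict (P : I.Plan) (p : I.Item → Bool) :
    (restrict P p).flatten = P.flatten.filter p := by
  unfold restrict
  rw [List.filter_flatten]
  induction P with
  | nil => rfl
  | cons B P ih =>
    rw [List.map_cons, List.filter_cons]
    split_ifs with h
    · simpa using ih
    · have : B.filter p = [] := by
        simpa only [Bool.not_eq_true', Bool.not_eq_false, List.isEmpty_iff] using h
      rw [ih, List.flatten_cons, this, List.nil_append]

lemma mem_restrict {P : I.Plan} {p : I.Item → Bool} {B : List I.Item} :
    B ∈ restrict P p ↔ B ≠ [] ∧ ∃ B' ∈ P, B'.filter p = B := by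
  simp only [restrict, List.mem_filter, List.mem_map]
  rw [and_comm]
  simp

/-- Deleted items, and the unloading stops of batches that become void, merely disappear from the
route; with `walk_sublist` the restricted plan is no longer than the original. -/
lemma route_restrict_sublist (sys : PickingSystem) (P : I.Plan) (p : I.Item → Bool) :
    (route sys (I.actions (restrict P p))).Sublist (route sys (I.actions P)) := by
  induction P with
  | nil => exact List.Sublist.refl _
  | cons B P ih =>
    unfold restrict at ih ⊢
    rw [actions_cons, route_append, List.map_cons, List.filter_cons]
    split_ifs with h
    · rw [actions_cons, route_append]
      refine List.Sublist.append ?_ ih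
      rw [route_batchActions, route_batchActions]
      exact (List.filter_sublist.map I.loc).append (List.Sublist.refl _)
    · exact ih.trans (List.sublist_append_right _ _)

lemma unsplit_restrict {P : I.Plan} {p : I.Item → Bool}
    (h : ∀ B ∈ P, ∀ x ∈ B, ∀ y ∈ P.flatten, y.1 = x.1 → y ∈ B) :
    ∀ B ∈ restrict P p, ∀ x ∈ B, ∀ y ∈ (restrict P p).flatten, y.1 = x.1 → y ∈ B := by
  intro B hB x hx y hy e
  obtain ⟨_, B', hB', rfl⟩ := mem_restrict.1 hB
  rw [flatten_restrict, List.mem_filter] at hy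
  exact List.mem_filter.2 ⟨h B' hB' x (List.mem_filter.1 hx).1 y hy.1 e, hy.2⟩

lemma capacity_restrict {s : I.State} {A : Finset (Fin I.n)} {P : I.Plan} {p : I.Item → Bool}
    (h : I.Feasible s A P) : ∀ B ∈ restrict P p, (I.ordersOf B).card ≤ w.c := by
  intro B hB
  obtain ⟨_, B', hB', rfl⟩ := mem_restrict.1 hB
  exact (Finset.card_le_card (ordersOf_mono List.filter_sublist.subset)).trans (h.capacity hB')

/-- A plan for everything can be restricted to what remains, if the cart is empty. -/
lemma Feasible.restrict_remaining {Q : I.Plan} (hQ : I.Feasible I.init Finset.univ Q)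
    (s : I.State) (hs : s.cart = ∅) (A : Finset (Fin I.n)) :
    I.Feasible s A (restrict Q fun x => decide (x.1 ∈ A ∧ x ∉ s.picked)) := by
  have hcap := capacity_restrict (p := fun x => decide (x.1 ∈ A ∧ x ∉ s.picked)) hQ
  have hall : ∀ x : I.Item, x ∈ Q.flatten := fun x => (hQ.complete x).2 (by simp [init])
  refine ⟨by rw [flatten_restrict]; exact hQ.nodup.filter _, fun x => ?_,
    unsplit_restrict hQ.unsplit, fun x _ hx => by simp [hs] at hx, fun h => by simp [hs] at h, ?_,
    fun B hB => hcap B (List.mem_of_mem_tail hB), fun _ B hB => (mem_restrict.1 hB).1,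
    fun B hB => (mem_restrict.1 (List.mem_of_mem_tail hB)).1⟩
  · rw [flatten_restrict, List.mem_filter]
    simp [hall x]
  · rw [hs, Finset.empty_union]
    generalize restrict Q _ = R at hcap
    cases R with
    | nil => simp
    | cons B R => exact hcap B (by simp)

/-- The plan that first completes the commenced orders, then follows a given plan. -/
lemma Feasible.restrict_after {Q : I.Plan} (hQ : I.Feasible I.init Finset.univ Q)
    (s : I.State) (hs : s.cart.Nonempty) (hcap : s.cart.card ≤ w.c) (C : List I.Item)
    (hnd : C.Nodup) (hC : ∀ x, x ∈ C ↔ x.1 ∈ s.cart ∧ x ∉ s.picked) :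
    I.Feasible s Finset.univ
      (C :: restrict Q fun x => decide (x.1 ∉ s.cart ∧ x ∉ s.picked)) := by
  have hcap' := capacity_restrict (p := fun x => decide (x.1 ∉ s.cart ∧ x ∉ s.picked)) hQ
  have hall : ∀ x : I.Item, x ∈ Q.flatten := fun x => (hQ.complete x).2 (by simp [init])
  have hmem : ∀ x, x ∈ (restrict Q fun x => decide (x.1 ∉ s.cart ∧ x ∉ s.picked)).flatten ↔
      x.1 ∉ s.cart ∧ x ∉ s.picked := fun x => by
    rw [flatten_restrict, List.mem_filter]; simp [hall x]
  refine ⟨?_, fun x => ?_, fun B hB x hx y hy e => ?_, fun x hx hxs => ?_, fun _ => by simp, ?_,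
    hcap', fun h => absurd h hs.ne_empty, fun B hB => (mem_restrict.1 hB).1⟩
  · rw [List.flatten_cons, List.nodup_append]
    refine ⟨hnd, by rw [flatten_restrict]; exact hQ.nodup.filter _, ?_⟩
    rintro x hx y hy rfl
    exact ((hmem x).1 hy).1 ((hC x).1 hx).1
  · rw [List.flatten_cons, List.mem_append, hC, hmem]
    simp only [Finset.mem_univ, true_and]
    tauto
  · rw [List.flatten_cons, List.mem_append] at hy
    rcases List.mem_cons.1 hB with rfl | hB
    · rcases hy with hy | hy
      · exact hy
      · exact absurd (e ▸ ((hC x).1 hx).1) ((hmem y).1 hy).1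
    · have hx' := (hmem x).1 (List.mem_flatten.2 ⟨B, hB, hx⟩)
      rcases hy with hy | hy
      · exact absurd (e ▸ ((hC y).1 hy).1) hx'.1
      · exact unsplit_restrict hQ.unsplit B hB x hx y hy e
  · rw [List.flatten_cons, List.mem_append] at hx
    rcases hx with hx | hx
    · exact hx
    · exact absurd hxs ((hmem x).1 hx).1
  · rw [List.headD_cons, Finset.union_eq_left.2]
    · exact hcap
    · intro j hj
      obtain ⟨x, hx, rfl⟩ := mem_ordersOf.1 hj
      exact ((hC x).1 hx).1

end Instance

end OOBSRP

end

noncomputable section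

namespace OOBSRP

variable {w : Warehouse}

namespace Instance

open Warehouse

variable {I : Instance w}

/-! ### What Reopt has done can be prepended to every plan -/

/-- Every plan for the rest of the instance from state `s` at time `τ` can be extended to a plan
for the whole instance that is completed at least as early. -/
def Extendable (sys : PickingSystem) (s : I.State) (τ : ℝ) : Prop :=
  ∀ P : I.Plan, I.Feasible s Finset.univ P → ∃ Q : I.Plan, I.Feasible I.init Finset.univ Q ∧
    completion sys w.depot 0 (I.actions Q) ≤ completion sys s.pos τ (I.actions P)

lemma extendable_init (sys : PickingSystem) {τ : ℝ} (hτ : 0 ≤ τ) :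
    Extendable sys I.init τ :=
  fun P hP => ⟨P, hP, completion_mono sys (by simpa [init] using hτ) _⟩

lemma Extendable.mono {sys : PickingSystem} {s : I.State} {τ τ' : ℝ} {q : w.Pt}
    (h : Extendable sys s τ) (hq : τ + w.d s.pos q ≤ τ') :
    Extendable sys ⟨q, s.picked, s.cart⟩ τ' := by
  intro P hP
  obtain ⟨Q, hQ, hle⟩ := h P (feasible_congr (s := ⟨q, s.picked, s.cart⟩) rfl rfl hP)
  exact ⟨Q, hQ, hle.trans (completion_mono sys hq _)⟩

lemma Extendable.pick {sys : PickingSystem} {s : I.State} {τ : ℝ} {x : I.Item}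
    (h : Extendable sys s τ) (hx : x ∉ s.picked) (hτ : I.arrival x.1 ≤ τ) :
    Extendable sys (perform sys s (.pick x)) (τ + w.d s.pos (I.loc x)) := by
  intro P hP
  obtain ⟨B, P, rfl, hP'⟩ := hP.of_pick hx (Finset.mem_univ _)
  obtain ⟨Q, hQ, hle⟩ := h _ hP'
  refine ⟨Q, hQ, hle.trans ?_⟩
  rw [actions_cons_cons, completion, max_eq_left (by linarith [d_nonneg s.pos (I.loc x)])]
  exact le_rfl

lemma Extendable.unload {sys : PickingSystem} {s : I.State} {τ : ℝ} (h : Extendable sys s τ)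
    (hne : s.cart.Nonempty) (hc : s.cart.card ≤ w.c)
    (hs : ∀ x : I.Item, x.1 ∈ s.cart → x ∈ s.picked) :
    Extendable sys (perform sys s .unload)
      (τ + w.d s.pos (target (I := I) sys s.pos .unload)) := by
  intro P hP
  exact h _ (hP.of_unload hne hc hs)

/-- Each completed action is moved to the front of the remaining plan. An interrupted walk is
harmless: the point reached is at a distance equal to the time spent, so `Extendable.mono` absorbs
it. The inclusion of the cart in `A` guarantees that an unloaded cart holds only complete orders. -/
lemma RunUntil.extendable {sys : PickingSystem} {T : ℝ} {s s' : I.State} {τ : ℝ}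
    {l : List I.Action} (h : I.RunUntil sys T s τ l s') :
    ∀ (P : I.Plan) (A : Finset (Fin I.n)), l = I.actions P → I.Feasible s A P →
      (∀ j ∈ A, I.arrival j ≤ τ) → s.cart ⊆ A → Extendable sys s τ → τ ≤ T →
      Extendable sys s' T ∧ s'.cart ⊆ A := by
  induction h with
  | idle s τ =>
    intro P A _ _ _ hs hext hT
    exact ⟨hext.mono (q := s.pos) (by simpa using hT), hs⟩
  | @act s s' τ α l h hrun ih =>
    intro P A hl hP hA hs hext hT
    match P with
    | [] => simp at hl
    | [] :: P =>
      obtain ⟨rfl, rfl⟩ : α = .unload ∧ l = I.actions P := by simpa using hl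
      refine ih P A rfl (hP.unload sys) (fun j hj => ?_) (by simp [perform])
        (hext.unload hP.cart_nonempty hP.card_cart_le (hP.cart_complete hs)) h
      linarith [hA j hj, d_nonneg s.pos (target (I := I) sys s.pos .unload)]
    | (x :: B) :: P =>
      obtain ⟨rfl, rfl⟩ : α = .pick x ∧ l = I.actions (B :: P) := by simpa using hl
      have hx := (hP.complete x).1 (by simp)
      refine ih (B :: P) A rfl (hP.pick sys) (fun j hj => ?_) ?_ (hext.pick hx.2 (hA _ hx.1)) h
      · linarith [hA j hj, d_nonneg s.pos (target (I := I) sys s.pos (.pick x))]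
      · intro j hj
        rcases Finset.mem_insert.1 hj with rfl | hj
        exacts [hx.1, hs hj]
  | walking q h hq hq' =>
    intro P A _ _ _ hs hext _
    exact ⟨hext.mono (by rw [hq]; linarith), hs⟩

/-- At unit speed the picker cannot be farther from the depot than the elapsed time. This pays for a
return to the depot in the factor 5. -/
lemma RunUntil.d_depot_le {sys : PickingSystem} {T : ℝ} {s s' : I.State} {τ : ℝ}
    {l : List I.Action} (h : I.RunUntil sys T s τ l s') (hτ : τ ≤ T)
    (hs : w.d w.depot s.pos ≤ τ) : w.d w.depot s'.pos ≤ T := by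
  induction h with
  | idle s τ => exact hs.trans hτ
  | @act s s' τ α l h hrun ih =>
    refine ih h ?_
    have : (perform sys s α).pos = target sys s.pos α := by cases α <;> rfl
    rw [this]
    linarith [d_triangle w.depot s.pos (target sys s.pos α)]
  | @walking s τ α l q h hq hq' =>
    linarith [d_triangle w.depot s.pos q]

/-- All targets are the depot at distance 0, so she is never caught on the way. -/
lemma RunUntil.pos_eq_depot {T : ℝ} {s s' : I.State} {τ : ℝ} {l : List I.Action}
    (hloc : ∀ x, I.loc x = w.depot) (h : I.RunUntil .pcart T s τ l s') (hτ : τ ≤ T)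
    (hs : s.pos = w.depot) : s'.pos = w.depot := by
  have htar : ∀ (p : w.Pt) (α : I.Action), target .pcart p α = w.depot := by
    intro p α
    cases α
    exacts [hloc _, rfl]
  induction h with
  | idle s τ => exact hs
  | @act s s' τ α l h hrun ih =>
    exact ih h (by cases α; exacts [hloc _, rfl])
  | @walking s τ α l q h hq hq' =>
    rw [htar, hs, d_self] at h
    linarith

/-- Only the last replanning matters: it covers all orders and is executed to the end. The past
enters through three invariants, carried from one arrival to the next: extendability, the distance
to the depot, and the position when all items are at the depot. -/
lemma InterventionistResult.exists_last {sys : PickingSystem} {V : ℝ} (hn : 0 < I.n)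
    (hmono : Monotone I.arrival) (h0 : ∀ j, 0 ≤ I.arrival j)
    (h : I.InterventionistResult sys V) :
    ∃ (s : I.State) (P : I.Plan) (j : Fin I.n), (∀ k, I.arrival k ≤ I.arrival j) ∧
      I.OptimalPlan sys s (I.arrival j) Finset.univ P ∧
      V = completion sys s.pos (I.arrival j) (I.actions P) ∧
      Extendable sys s (I.arrival j) ∧ w.d w.depot s.pos ≤ I.arrival j ∧
      (sys = .pcart → (∀ x, I.loc x = w.depot) → s.pos = w.depot) := by
  obtain ⟨-, s, P, hinit, hopt, hrun, hV⟩ := h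
  have harr : ∀ j, ∀ k ∈ I.arrived (I.arrival j), I.arrival k ≤ I.arrival j := by
    intro j k hk
    simpa [arrived] using hk
  have inv : ∀ (m : ℕ) (hm : m < I.n), Extendable sys (s ⟨m, hm⟩) (I.arrival ⟨m, hm⟩) ∧
      (s ⟨m, hm⟩).cart ⊆ I.arrived (I.arrival ⟨m, hm⟩) ∧
      w.d w.depot (s ⟨m, hm⟩).pos ≤ I.arrival ⟨m, hm⟩ ∧
      (sys = .pcart → (∀ x, I.loc x = w.depot) → (s ⟨m, hm⟩).pos = w.depot) := by
    intro m
    induction m with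
    | zero =>
      intro hm
      rw [hinit ⟨0, hm⟩ rfl]
      exact ⟨extendable_init sys (h0 _), by simp [init], by simpa [init] using h0 _,
        fun _ _ => rfl⟩
    | succ m ih =>
      intro hm
      have hm' : m < I.n := by omega
      obtain ⟨h1, h2, h3, h4⟩ := ih hm'
      have hle : I.arrival ⟨m, hm'⟩ ≤ I.arrival ⟨m + 1, hm⟩ := hmono (by simp)
      have hr := hrun ⟨m, hm'⟩ ⟨m + 1, hm⟩ rfl
      obtain ⟨h5, h6⟩ := hr.extendable _ _ rfl (hopt ⟨m, hm'⟩).1 (harr _) h2 h1 hle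
      refine ⟨h5, fun j hj => ?_, hr.d_depot_le hle h3, ?_⟩
      · have := harr _ j (h6 hj)
        simpa [arrived] using this.trans hle
      · rintro rfl hloc
        exact hr.pos_eq_depot hloc hle (h4 rfl hloc)
  have hlast : I.n - 1 < I.n := by omega
  have hmax : ∀ k, I.arrival k ≤ I.arrival ⟨I.n - 1, hlast⟩ := fun k =>
    hmono (by rw [Fin.le_def]; have := k.2; simp only; omega)
  have huniv : I.arrived (I.arrival ⟨I.n - 1, hlast⟩) = Finset.univ := by
    ext k; simpa [arrived] using hmax k
  obtain ⟨h1, -, h3, h4⟩ := inv (I.n - 1) hlast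
  refine ⟨_, P ⟨I.n - 1, hlast⟩, ⟨I.n - 1, hlast⟩, hmax, ?_, hV _ (by simp only; omega), h1, h3, h4⟩
  have := hopt ⟨I.n - 1, hlast⟩
  rwa [huniv] at this

/-! ### Upper bounds for interventionist reoptimization -/

/-- The competitor completes the commenced orders in the sequence `C`, returns to the depot and
follows what is left of `Q`. Since all orders have arrived, its cost is pure walking. -/
lemma OptimalPlan.completion_le {sys : PickingSystem} {s : I.State} {R : ℝ} {P : I.Plan}
    (h : I.OptimalPlan sys s R Finset.univ P) (hR : ∀ k, I.arrival k ≤ R) {Q : I.Plan}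
    (hQ : I.Feasible I.init Finset.univ Q) {C : List I.Item} (hnd : C.Nodup)
    (hC : ∀ x, x ∈ C ↔ x.1 ∈ s.cart ∧ x ∉ s.picked) :
    completion sys s.pos R (I.actions P) ≤
      R + walk s.pos (C.map I.loc ++ [w.depot]) + walk w.depot (route sys (I.actions Q)) := by
  rcases s.cart.eq_empty_or_nonempty with hs | hs
  · refine (h.2 _ (hQ.restrict_remaining s hs _)).trans ?_
    rw [completion_eq _ _ _ _ (fun x _ => hR _), add_assoc]
    refine add_le_add_right ((walk_le_d_add_walk _ w.depot _).trans (add_le_add ?_ ?_)) _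
    · simpa using walk_sublist (List.sublist_append_right (C.map I.loc) [w.depot]) s.pos
    · exact walk_sublist (route_restrict_sublist _ _ _) _
  · refine (h.2 _ (hQ.restrict_after s hs h.1.card_cart_le C hnd hC)).trans ?_
    rw [completion_eq _ _ _ _ (fun x _ => hR _), add_assoc]
    refine add_le_add_right ?_ _
    -- A robot spares the picker the return, but a detour over the depot is affordable in an upper
    -- bound and makes the systems uniform.
    have hsub : (unloadStops w sys).Sublist [w.depot] := by cases sys <;> simp [unloadStops]
    rw [actions_cons, route_append, route_batchActions]
    refine (walk_sublist (((List.Sublist.refl _).append hsub).append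
      (route_restrict_sublist sys Q _)) _).trans ?_
    rw [walk_append]
    simp

lemma loc_onAisle (x : I.Item) : w.OnAisle (I.loc x).1 := (I.order x.1).2.2.2 x.2

/-- Additive bound: the commenced orders are finished along a short tour through the aisles, and the
return costs at most `diam`. -/
lemma OptimalPlan.completion_le_tourBound {sys : PickingSystem} {s : I.State} {R : ℝ} {P : I.Plan}
    (h : I.OptimalPlan sys s R Finset.univ P) (hR : ∀ k, I.arrival k ≤ R) {Q : I.Plan}
    (hQ : I.Feasible I.init Finset.univ Q) :
    completion sys s.pos R (I.actions P) ≤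
      R + (w.tourBound + w.diam) + walk w.depot (route sys (I.actions Q)) := by
  obtain ⟨C, hC, hlen⟩ := exists_perm_walk_le I.loc
    (Finset.univ.filter fun x : I.Item => x.1 ∈ s.cart ∧ x ∉ s.picked).toList
    fun x _ => loc_onAisle x
  refine (h.completion_le hR hQ (hC.nodup_iff.2 (Finset.nodup_toList _))
    (fun x => by rw [hC.mem_iff]; simp)).trans ?_
  linarith [hlen s.pos, walk_append_singleton_le s.pos w.depot (C.map I.loc)]

lemma map_loc_flatten_sublist (sys : PickingSystem) (P : I.Plan) :
    (P.flatten.map I.loc).Sublist (route sys (I.actions P)) := by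
  induction P with
  | nil => exact List.Sublist.refl _
  | cons B P ih =>
    rw [List.flatten_cons, List.map_append, actions_cons, route_append, route_batchActions]
    exact (List.sublist_append_left _ _).append ih

/-- Multiplicative bound: the commenced orders are finished in the sequence in which `Q` visits
their items. That walk from the depot, the way back and `Q` itself each cost at most the length of
`Q`, whence the factor 3. -/
lemma OptimalPlan.completion_le_walk {sys : PickingSystem} {s : I.State} {R : ℝ} {P : I.Plan}
    (h : I.OptimalPlan sys s R Finset.univ P) (hR : ∀ k, I.arrival k ≤ R) {Q : I.Plan}
    (hQ : I.Feasible I.init Finset.univ Q) :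
    completion sys s.pos R (I.actions P) ≤
      R + w.d s.pos w.depot + 3 * walk w.depot (route sys (I.actions Q)) := by
  let p : I.Item → Bool := fun x => decide (x.1 ∈ s.cart ∧ x ∉ s.picked)
  have hC := h.completion_le hR hQ (hQ.nodup.filter p) (fun x => by
    have : x ∈ Q.flatten := (hQ.complete x).2 (by simp [init])
    rw [List.mem_filter]
    simp [this, p])
  refine hC.trans ?_
  have h1 : walk w.depot ((Q.flatten.filter p).map I.loc) ≤
      walk w.depot (route sys (I.actions Q)) :=
    walk_sublist ((List.filter_sublist.map I.loc).trans (map_loc_flatten_sublist sys Q)) _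
  have h2 := walk_le_d_add_walk s.pos w.depot ((Q.flatten.filter p).map I.loc ++ [w.depot])
  rw [walk_append w.depot] at h2
  have h3 := d_getLastD_le_walk w.depot ((Q.flatten.filter p).map I.loc)
  rw [d_comm] at h3
  simp only [walk_cons, walk_nil] at h2
  linarith

/-! ### Non-interventionist reoptimization -/

lemma Feasible.batch {D : Finset I.Item} {A : Finset (Fin I.n)} {B : List I.Item}
    {P : I.Plan} (h : I.Feasible ⟨w.depot, D, ∅⟩ A (B :: P)) :
    I.Feasible ⟨w.depot, D ∪ B.toFinset, ∅⟩ A P := by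
  have hnd := h.nodup
  rw [List.flatten_cons, List.nodup_append] at hnd
  refine ⟨hnd.2.1, fun x => ?_, fun B' hB' x hx y hy => h.unsplit B' (by simp [hB']) x hx y
    (by simp [hy]), by simp, by simp, ?_, fun B' hB' => h.capacity_tail B' ?_,
    fun _ => h.nonempty_tail, fun B' hB' => h.nonempty_tail B' (List.mem_of_mem_tail hB')⟩
  · have h1 := h.complete x
    rw [List.flatten_cons, List.mem_append] at h1
    simp only [Finset.mem_union, List.mem_toFinset, not_or]
    constructor
    · intro hx
      have h2 := h1.1 (Or.inr hx)
      exact ⟨h2.1, h2.2, fun hB => hnd.2.2 x hB x hx rfl⟩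
    · rintro ⟨h2, h3, h4⟩
      exact (h1.2 ⟨h2, h3⟩).resolve_left h4
  · cases P with
    | nil => simp
    | cons B' P => simpa using h.capacity_tail B' (by simp)
  · exact List.mem_of_mem_tail hB'

lemma Feasible.of_batch {D : Finset I.Item} {A A' : Finset (Fin I.n)} {B : List I.Item}
    {P Q : I.Plan} (h : I.Feasible ⟨w.depot, D, ∅⟩ A (B :: P)) (hA : A ⊆ A')
    (hQ : I.Feasible ⟨w.depot, D ∪ B.toFinset, ∅⟩ A' Q) :
    I.Feasible ⟨w.depot, D, ∅⟩ A' (B :: Q) := by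
  have hnd := h.nodup
  rw [List.flatten_cons, List.nodup_append] at hnd
  have hB : ∀ x ∈ B, x.1 ∈ A ∧ x ∉ D := fun x hx => (h.complete x).1 (by simp [hx])
  have hQm : ∀ x ∈ Q.flatten, x.1 ∈ A' ∧ x ∉ D ∧ x ∉ B := fun x hx => by
    simpa using (hQ.complete x).1 hx
  -- Feasibility of `B :: P` puts all remaining items of an order of `B` into `B`, so no such order
  -- reappears in `Q`, although `Q` may contain orders that `P` did not know.
  have hsep : ∀ x ∈ B, ∀ y ∈ Q.flatten, y.1 ≠ x.1 := by
    intro x hx y hy e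
    have hy' := hQm y hy
    have : y ∈ (B :: P).flatten := (h.complete y).2 ⟨e ▸ (hB x hx).1, hy'.2.1⟩
    exact hy'.2.2 (h.unsplit B (by simp) x hx y this e)
  refine ⟨?_, fun x => ?_, fun B' hB' x hx y hy e => ?_, by simp, by simp, h.capacity_head,
    fun B' hB' => hQ.capacity hB', fun _ B' hB' => ?_, hQ.nonempty_head rfl⟩
  · rw [List.flatten_cons, List.nodup_append]
    refine ⟨hnd.1, hQ.nodup, ?_⟩
    rintro x hx y hy rfl
    exact hsep x hx x hy rfl
  · rw [List.flatten_cons, List.mem_append, hQ.complete]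
    simp only [Finset.mem_union, List.mem_toFinset, not_or]
    constructor
    · rintro (hx | hx)
      exacts [⟨hA (hB x hx).1, (hB x hx).2⟩, ⟨hx.1, hx.2.1⟩]
    · rintro ⟨h1, h2⟩
      by_cases hx : x ∈ B
      exacts [Or.inl hx, Or.inr ⟨h1, h2, hx⟩]
  · rw [List.flatten_cons, List.mem_append] at hy
    rcases List.mem_cons.1 hB' with rfl | hB'
    · exact hy.resolve_right fun hy => hsep x hx y hy e
    · have hx' : x ∈ Q.flatten := List.mem_flatten.2 ⟨B', hB', hx⟩
      refine hQ.unsplit B' hB' x hx y (hy.resolve_left fun hy => ?_) e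
      exact hsep y hy x hx' e.symm
  · rcases List.mem_cons.1 hB' with rfl | hB'
    · exact h.nonempty_head rfl _ (by simp)
    · exact hQ.nonempty_head rfl _ hB'

lemma Feasible.perm_head {D : Finset I.Item} {A : Finset (Fin I.n)} {B B' : List I.Item}
    {P : I.Plan} (h : I.Feasible ⟨w.depot, D, ∅⟩ A (B :: P)) (hB : B'.Perm B) :
    I.Feasible ⟨w.depot, D, ∅⟩ A (B' :: P) := by
  have hfl : (B' :: P).flatten.Perm (B :: P).flatten := by
    simpa using hB.append_right P.flatten
  have hord : I.ordersOf B' = I.ordersOf B := by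
    ext j; simp only [mem_ordersOf, hB.mem_iff]
  refine ⟨hfl.nodup_iff.2 h.nodup, fun x => by rw [hfl.mem_iff, h.complete],
    fun C hC x hx y hy e => ?_, by simp, by simp, by simpa [hord] using h.capacity_head,
    h.capacity_tail, fun _ C hC => ?_, h.nonempty_tail⟩
  · rw [hfl.mem_iff] at hy
    rcases List.mem_cons.1 hC with rfl | hC
    · rw [hB.mem_iff] at hx ⊢
      exact h.unsplit B (by simp) x hx y hy e
    · exact h.unsplit C (by simp [hC]) x hx y hy e
  · rcases List.mem_cons.1 hC with rfl | hC
    · rintro rfl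
      exact h.nonempty_head rfl B (by simp) (List.nil_perm.1 hB)
    · exact h.nonempty_tail C hC

lemma completion_cons_pcartN (τ : ℝ) (B : List I.Item) (P : I.Plan) :
    completion .pcartN w.depot τ (I.actions (B :: P)) =
      completion .pcartN w.depot (completion .pcartN w.depot τ (I.batchActions B))
        (I.actions P) := by
  rw [actions_cons, completion_append, route_batchActions]
  simp [unloadStops]

/-- Extendability is carried along the run, one whole batch at a time; replanning leaves the past
unchanged, and waiting only lets time pass. -/
lemma NonInterventionistRun.exists_plan {τ : ℝ} {A : Finset (Fin I.n)} {D : Finset I.Item}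
    {P : I.Plan} {V : ℝ} (h : I.NonInterventionistRun τ A D P V)
    (hP : I.Feasible ⟨w.depot, D, ∅⟩ A P) (hext : Extendable .pcartN ⟨w.depot, D, ∅⟩ τ) :
    ∃ Q : I.Plan, I.Feasible I.init Finset.univ Q ∧
      completion .pcartN w.depot 0 (I.actions Q) ≤ V := by
  induction h with
  | replan P' hnew hopt hrun ih => exact ih hopt.1 hext
  | @batch τ A D B P V hold hrun ih =>
    refine ih hP.batch fun Q hQ => ?_
    obtain ⟨Q', hQ', hle⟩ := hext _ (hP.of_batch (Finset.subset_univ A) hQ)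
    exact ⟨Q', hQ', hle.trans_eq (completion_cons_pcartN _ _ _)⟩
  | @wait τ A D V j hold hj hmin hrun ih =>
    refine ih hP (hext.mono (q := w.depot) ?_)
    rw [← hold] at hj
    simp only [arrived, Finset.mem_filter, Finset.mem_univ, true_and, not_le] at hj
    simpa using hj.le
  | finish hall => exact hext [] hP

/-- Principle of optimality: a better continuation would improve the whole plan. -/
lemma OptimalPlan.tail {D : Finset I.Item} {A : Finset (Fin I.n)} {B : List I.Item}
    {P : I.Plan} {τ : ℝ} (h : I.OptimalPlan .pcartN ⟨w.depot, D, ∅⟩ τ A (B :: P)) :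
    I.OptimalPlan .pcartN ⟨w.depot, D ∪ B.toFinset, ∅⟩
      (completion .pcartN w.depot τ (I.batchActions B)) A P := by
  refine ⟨h.1.batch, fun Q hQ => ?_⟩
  have := h.2 _ (h.1.of_batch subset_rfl hQ)
  simpa only [completion_cons_pcartN] using this

lemma Feasible.arrival_le {s : I.State} {A : Finset (Fin I.n)} {P : I.Plan}
    (h : I.Feasible s A P) {τ : ℝ} (hA : ∀ j ∈ A, I.arrival j ≤ τ) (x : I.Item)
    (hx : Action.pick x ∈ I.actions P) : I.arrival x.1 ≤ τ :=
  hA _ ((h.complete x).1 (pick_mem_actions.1 hx)).1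

lemma OptimalPlan.walk_le {D : Finset I.Item} {A : Finset (Fin I.n)} {P : I.Plan} {τ : ℝ}
    (h : I.OptimalPlan .pcartN ⟨w.depot, D, ∅⟩ τ A P) (hA : ∀ j ∈ A, I.arrival j ≤ τ)
    {Q : I.Plan} (hQ : I.Feasible ⟨w.depot, D, ∅⟩ A Q) :
    walk w.depot (route .pcartN (I.actions P)) ≤ walk w.depot (route .pcartN (I.actions Q)) := by
  have := h.2 Q hQ
  rw [completion_eq _ _ _ _ (h.1.arrival_le hA), completion_eq _ _ _ _ (hQ.arrival_le hA)] at this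
  linarith

lemma OptimalPlan.walk_le_of_init {D : Finset I.Item} {A : Finset (Fin I.n)} {P : I.Plan} {τ : ℝ}
    (h : I.OptimalPlan .pcartN ⟨w.depot, D, ∅⟩ τ A P) (hA : ∀ j ∈ A, I.arrival j ≤ τ)
    {Q : I.Plan} (hQ : I.Feasible I.init Finset.univ Q) :
    walk w.depot (route .pcartN (I.actions P)) ≤ walk w.depot (route .pcartN (I.actions Q)) :=
  (h.walk_le hA (hQ.restrict_remaining ⟨w.depot, D, ∅⟩ rfl A)).trans
    (walk_sublist (route_restrict_sublist _ _ _) _)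

lemma walk_actions_cons_pcartN (B : List I.Item) (P : I.Plan) :
    walk w.depot (route .pcartN (I.actions (B :: P))) =
      walk w.depot (B.map I.loc ++ [w.depot]) + walk w.depot (route .pcartN (I.actions P)) := by
  rw [actions_cons, route_append, walk_append, route_batchActions]
  simp [unloadStops]

/-- Exchange argument: resequencing the first batch along a short tour leaves the rest of the plan
unchanged, so an optimal plan cannot have a longer first batch. -/
lemma OptimalPlan.walk_head_le {D : Finset I.Item} {A : Finset (Fin I.n)} {B : List I.Item}
    {P : I.Plan} {τ : ℝ} (h : I.OptimalPlan .pcartN ⟨w.depot, D, ∅⟩ τ A (B :: P))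
    (hA : ∀ j ∈ A, I.arrival j ≤ τ) :
    walk w.depot (B.map I.loc ++ [w.depot]) ≤ w.tourBound + w.diam := by
  obtain ⟨B', hB', hlen⟩ := exists_perm_walk_le I.loc B fun x _ => loc_onAisle x
  have := h.walk_le hA (h.1.perm_head hB')
  rw [walk_actions_cons_pcartN, walk_actions_cons_pcartN] at this
  linarith [hlen w.depot, walk_append_singleton_le w.depot w.depot (B'.map I.loc)]

/-- `M` bounds the duration of a single batch. A batch begun before the last arrival `R` ends by `R
+ M`, so the plan that finally covers all orders starts by then, and it is no longer than `Q`. Once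
all orders are in the plan, only its own length remains. -/
lemma NonInterventionistRun.le {τ : ℝ} {A : Finset (Fin I.n)} {D : Finset I.Item}
    {P : I.Plan} {V : ℝ} (h : I.NonInterventionistRun τ A D P V) {R M : ℝ}
    (hM0 : 0 ≤ M) (hR : ∀ k, I.arrival k ≤ R) {Q : I.Plan} (hQ : I.Feasible I.init Finset.univ Q)
    (hM : ∀ (τ : ℝ) (A : Finset (Fin I.n)) (D : Finset I.Item) (B : List I.Item) (P : I.Plan),
      I.OptimalPlan .pcartN ⟨w.depot, D, ∅⟩ τ A (B :: P) → (∀ j ∈ A, I.arrival j ≤ τ) →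
      walk w.depot (B.map I.loc ++ [w.depot]) ≤ M)
    (hP : I.OptimalPlan .pcartN ⟨w.depot, D, ∅⟩ τ A P) (hA : ∀ j ∈ A, I.arrival j ≤ τ) :
    (A = Finset.univ → V ≤ τ + walk w.depot (route .pcartN (I.actions P))) ∧
    (A ≠ Finset.univ → τ ≤ R + M →
      V ≤ R + M + walk w.depot (route .pcartN (I.actions Q))) := by
  induction h with
  | @replan τ A D P V P' hnew hopt hrun ih =>
    have harr : ∀ j ∈ I.arrived τ, I.arrival j ≤ τ := fun j hj => by simpa [arrived] using hj
    obtain ⟨ih1, ih2⟩ := ih hopt harr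
    refine ⟨fun hu => absurd ?_ hnew, fun _ hτ => ?_⟩
    · subst hu
      ext j; simpa [arrived] using hA j (Finset.mem_univ j)
    · by_cases hu : I.arrived τ = Finset.univ
      · linarith [ih1 hu, hopt.walk_le_of_init harr hQ]
      · exact ih2 hu hτ
  | @batch τ A D B P V hold hrun ih =>
    have hτ' : completion .pcartN w.depot τ (I.batchActions B) =
        τ + walk w.depot (B.map I.loc ++ [w.depot]) := by
      rw [completion_eq, route_batchActions]
      · rfl
      · intro x hx
        refine hP.1.arrival_le hA x ?_
        rw [actions_cons]
        exact List.mem_append_left _ hx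
    have hnn := walk_nonneg w.depot (B.map I.loc ++ [w.depot])
    obtain ⟨ih1, ih2⟩ := ih hP.tail (fun j hj => by rw [hτ']; linarith [hA j hj])
    refine ⟨fun hu => ?_, fun hu _ => ih2 hu ?_⟩
    · rw [walk_actions_cons_pcartN]
      linarith [ih1 hu]
    -- An order is still missing, so the batch starts before `R`.
    · obtain ⟨j, hj⟩ : ∃ j, j ∉ A := by
        by_contra hc
        push Not at hc
        exact hu (Finset.eq_univ_iff_forall.2 hc)
      rw [← hold] at hj
      simp only [arrived, Finset.mem_filter, Finset.mem_univ, true_and, not_le] at hj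
      rw [hτ']
      linarith [hR j, hM τ A D B P hP hA]
  | @wait τ A D V j hold hj hmin hrun ih =>
    have hj' := hj
    rw [← hold] at hj'
    simp only [arrived, Finset.mem_filter, Finset.mem_univ, true_and, not_le] at hj'
    obtain ⟨-, ih2⟩ := ih ⟨hP.1, fun Q hQ => le_completion _ _ _ _⟩
      (fun k hk => (hA k hk).trans hj'.le)
    have hu : A ≠ Finset.univ := by
      rintro rfl; exact hj (Finset.mem_univ j)
    refine ⟨fun hu' => absurd hu' hu, fun _ hτ => ?_⟩
    exact ih2 hu (by linarith [hR j])
  | finish hall => exact ⟨fun _ => by simp, fun h => absurd rfl h⟩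

/-- Two choices of `M`: the length of `Q`, because a batch is part of an optimal plan that is no
longer than `Q`, and the constant of `OptimalPlan.walk_head_le`. -/
lemma NonInterventionistRun.le_of_start {V : ℝ} (h : I.NonInterventionistRun 0 ∅ ∅ [] V)
    (hn : 0 < I.n) {R : ℝ} (hR0 : 0 ≤ R) (hR : ∀ k, I.arrival k ≤ R) {Q : I.Plan}
    (hQ : I.Feasible I.init Finset.univ Q) :
    V ≤ R + 2 * walk w.depot (route .pcartN (I.actions Q)) ∧
    V ≤ R + (w.tourBound + w.diam) + walk w.depot (route .pcartN (I.actions Q)) := by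
  have hopt : I.OptimalPlan .pcartN ⟨w.depot, ∅, ∅⟩ 0 ∅ [] :=
    ⟨⟨by simp, by simp, by simp, by simp, by simp, by simp, by simp, by simp, by simp⟩,
      fun Q _ => le_completion _ _ _ _⟩
  have hne : (∅ : Finset (Fin I.n)) ≠ Finset.univ :=
    fun e => Finset.notMem_empty (⟨0, hn⟩ : Fin I.n) (e ▸ Finset.mem_univ _)
  have hT := walk_nonneg w.depot (route .pcartN (I.actions Q))
  have hK : 0 ≤ w.tourBound + w.diam := by
    have := diam_nonneg (w := w)
    have := w.W_pos
    unfold tourBound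
    positivity
  constructor
  · have := (h.le hT hR hQ (fun τ A D B P hP hA => by
      have h1 := hP.walk_le_of_init hA hQ
      rw [walk_actions_cons_pcartN] at h1
      linarith [walk_nonneg w.depot (route .pcartN (I.actions P))]) hopt (by simp)).2 hne
      (by linarith)
    linarith
  · exact (h.le hK hR hQ (fun τ A D B P hP hA => hP.walk_head_le hA) hopt (by simp)).2 hne
      (by linarith)

/-! ### Comparison of Reopt with the plans for the whole instance -/

lemma Feasible.arrival_le_completion {Q : I.Plan} (hQ : I.Feasible I.init Finset.univ Q)
    (sys : PickingSystem) (j : Fin I.n) :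
    I.arrival j ≤ completion sys w.depot 0 (I.actions Q) := by
  have hk := (I.order j).2.1
  exact Instance.arrival_le_completion sys _ _ _ (⟨j, ⟨0, hk⟩⟩ : I.Item)
    (pick_mem_actions.2 ((hQ.complete _).2 (by simp [init])))

lemma walk_eq_zero {l : List w.Pt} (h : ∀ q ∈ l, q = w.depot) : walk w.depot l = 0 := by
  induction l with
  | nil => rfl
  | cons q l ih =>
    rw [walk_cons, h q (by simp), d_self, zero_add, ih fun q hq => h q (List.mem_cons_of_mem _ hq)]

lemma walk_route_eq_zero (sys : PickingSystem) (hloc : ∀ x, I.loc x = w.depot)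
    (l : List I.Action) : walk w.depot (route sys l) = 0 := by
  refine walk_eq_zero fun q hq => ?_
  obtain ⟨α, -, hα⟩ := List.mem_flatMap.1 hq
  cases α with
  | pick x => simpa [stops, hloc] using hα
  | unload =>
    cases sys with
    | robot => simp [stops, unloadStops] at hα
    | _ => simpa [stops, unloadStops] using hα

/-- The time `V` is at least as long as some plan, at most five times as long as any plan, and
exceeds any plan at most by the last arrival time and a constant. It does not exceed any plan if
all items are at the depot and the picker has a pushcart. -/
structure ComparesToPlans (I : Instance w) (sys : PickingSystem) (V : ℝ) : Prop where
  exists_le : ∃ Q : I.Plan, I.Feasible I.init Finset.univ Q ∧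
    completion sys w.depot 0 (I.actions Q) ≤ V
  le_mul : ∀ Q : I.Plan, I.Feasible I.init Finset.univ Q →
    V ≤ 5 * completion sys w.depot 0 (I.actions Q)
  le_add : ∀ Q : I.Plan, I.Feasible I.init Finset.univ Q → ∀ t, (∀ j, I.arrival j ≤ t) →
    V ≤ completion sys w.depot 0 (I.actions Q) + (t + (w.tourBound + w.diam))
  le_of_depot : ∀ Q : I.Plan, I.Feasible I.init Finset.univ Q → sys ≠ .robot →
    (∀ x, I.loc x = w.depot) → V ≤ completion sys w.depot 0 (I.actions Q)

lemma InterventionistResult.comparesToPlans {sys : PickingSystem} {V : ℝ} (hsys : sys ≠ .pcartN)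
    (h : I.InterventionistResult sys V) (hn : 0 < I.n) (hmono : Monotone I.arrival)
    (h0 : ∀ j, 0 ≤ I.arrival j) : ComparesToPlans I sys V := by
  obtain ⟨s, P, j, hR, hopt, hV, hext, hd, hdep⟩ := h.exists_last hn hmono h0
  refine ⟨by rw [hV]; exact hext P hopt.1, fun Q hQ => ?_, fun Q hQ t ht => ?_,
    fun Q hQ hrob hloc => ?_⟩
  all_goals
    have h1 := hopt.completion_le_walk hR hQ
    have h2 := hopt.completion_le_tourBound hR hQ
    have h3 := add_walk_le_completion sys w.depot 0 (I.actions Q)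
    have h4 := hQ.arrival_le_completion sys j
    rw [d_comm] at h1
    rw [← hV] at h1 h2
  -- The last arrival, the distance to the depot (at most the last arrival) and the length of `Q`
  -- are each at most the completion time of `Q`, and 1 + 1 + 3 = 5.
  · linarith
  · linarith [ht j]
  · have hs := hdep (by cases sys <;> simp_all) hloc
    rw [hs, d_self, walk_route_eq_zero sys hloc] at h1
    linarith

theorem IsReoptResult.comparesToPlans {sys : PickingSystem} {V : ℝ} (h : I.IsReoptResult V sys)
    (hn : 0 < I.n) (hmono : Monotone I.arrival) (h0 : ∀ j, 0 ≤ I.arrival j) :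
    ComparesToPlans I sys V := by
  cases sys with
  | pcart => exact InterventionistResult.comparesToPlans (by simp) h hn hmono h0
  | robot => exact InterventionistResult.comparesToPlans (by simp) h hn hmono h0
  | pcartN =>
    have h : I.NonInterventionistRun 0 ∅ ∅ [] V := h
    let j : Fin I.n := ⟨I.n - 1, by omega⟩
    have hR : ∀ k, I.arrival k ≤ I.arrival j := fun k =>
      hmono (by rw [Fin.le_def]; have := k.2; simp only [j]; omega)
    refine ⟨h.exists_plan ⟨by simp, by simp, by simp, by simp, by simp, by simp, by simp, by simp,
      by simp⟩ (extendable_init _ le_rfl), fun Q hQ => ?_, fun Q hQ t ht => ?_,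
      fun Q hQ _ hloc => ?_⟩
    all_goals
      obtain ⟨h1, h2⟩ := h.le_of_start hn (h0 j) hR hQ
      have h3 := add_walk_le_completion .pcartN w.depot 0 (I.actions Q)
      have h4 := hQ.arrival_le_completion .pcartN j
    · linarith [h0 j]
    · linarith [ht j]
    · rw [walk_route_eq_zero _ hloc] at h1
      linarith

/-! ### Lower bounds for the length of a plan -/

/-- An order that forces the picker to walk at least `δ` in every batch that contains it. -/
def Far (sys : PickingSystem) (δ : ℝ) (o : w.CustomerOrder) : Prop :=
  match sys with
  | .robot => ∃ i j, δ ≤ rect (o.1.2 i) (o.1.2 j)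
  | _ => ∃ i, δ ≤ rect w.depot (o.1.2 i)

lemma rect_le_walk_of_mem {p q : w.Pt} {l : List w.Pt} (hq : q ∈ l) : rect p q ≤ walk p l := by
  have := walk_sublist (List.singleton_sublist.2 hq) p
  exact (rect_le_d p q).trans (by simpa using this)

lemma rect_le_walk_of_mem_mem {p q q' : w.Pt} {l : List w.Pt} (hq : q ∈ l) (hq' : q' ∈ l) :
    rect q q' ≤ walk p l := by
  induction l generalizing p with
  | nil => simp at hq
  | cons r l ih =>
    rw [walk_cons]
    have hd := d_nonneg p r
    have hw := walk_nonneg r l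
    rcases List.mem_cons.1 hq with rfl | hql
    · rcases List.mem_cons.1 hq' with rfl | hql'
      · simpa [rect] using add_nonneg hd hw
      · linarith [rect_le_walk_of_mem (p := q) hql']
    · rcases List.mem_cons.1 hq' with rfl | hql'
      · rw [rect_comm]
        linarith [rect_le_walk_of_mem (p := q') hql]
      · linarith [ih (p := r) hql hql']

/-- Batch by batch: if a batch contains a far order, its walk is at least `δ` and it holds at most
`c` orders; otherwise it contributes nothing to the count. A pushcart starts each batch at the
depot. For a robot the start is arbitrary, since two distant items of one order lie in the same
batch. -/
lemma far_card_mul_le_walk (sys : PickingSystem) {δ : ℝ} (hδ : 0 ≤ δ)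
    (F : Finset (Fin I.n)) (hF : ∀ j ∈ F, Far sys δ (I.order j)) (P : I.Plan) (p : w.Pt)
    (hp : sys ≠ .robot → p = w.depot)
    (hfull : ∀ B ∈ P, ∀ x ∈ B, ∀ y : I.Item, y.1 = x.1 → y ∈ B)
    (hcap : ∀ B ∈ P, (I.ordersOf B).card ≤ w.c) :
    δ * (F ∩ I.ordersOf P.flatten).card ≤ w.c * walk p (route sys (I.actions P)) := by
  induction P generalizing p with
  | nil => simp
  | cons B P ih =>
    have hc : (1 : ℝ) ≤ w.c := by exact_mod_cast w.one_le_c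
    rw [actions_cons, route_append, walk_append, route_batchActions]
    have h1 := ih ((B.map I.loc ++ unloadStops w sys).getLastD p)
      (fun hs => by
        cases sys with
        | robot => exact absurd rfl hs
        | _ => simp [unloadStops])
      (fun B' hB' => hfull B' (by simp [hB'])) (fun B' hB' => hcap B' (by simp [hB']))
    have h2 : δ * (F ∩ I.ordersOf B).card ≤ w.c * walk p (B.map I.loc ++ unloadStops w sys) := by
      rcases (F ∩ I.ordersOf B).eq_empty_or_nonempty with he | ⟨j, hj⟩
      · rw [he]
        simpa using mul_nonneg (by linarith) (walk_nonneg _ _)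
      · have hle : δ ≤ walk p (B.map I.loc ++ unloadStops w sys) := by
          rw [Finset.mem_inter, mem_ordersOf] at hj
          obtain ⟨hjF, x, hx, rfl⟩ := hj
          have hmem : ∀ i, (I.order x.1).1.2 i ∈ B.map I.loc ++ unloadStops w sys := fun i =>
            List.mem_append_left _ (List.mem_map.2
              ⟨⟨x.1, i⟩, hfull B (by simp) x hx ⟨x.1, i⟩ rfl, rfl⟩)
          have hfar := hF _ hjF
          cases sys with
          | robot =>
            obtain ⟨i, k, hik⟩ := hfar
            exact hik.trans (rect_le_walk_of_mem_mem (hmem i) (hmem k))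
          | pcart =>
            obtain ⟨i, hi⟩ := hfar
            rw [hp (by simp)]
            exact hi.trans (rect_le_walk_of_mem (hmem i))
          | pcartN =>
            obtain ⟨i, hi⟩ := hfar
            rw [hp (by simp)]
            exact hi.trans (rect_le_walk_of_mem (hmem i))
        have hcard : ((F ∩ I.ordersOf B).card : ℝ) ≤ w.c := by
          exact_mod_cast (Finset.card_le_card Finset.inter_subset_right).trans (hcap B (by simp))
        rw [mul_comm]
        exact mul_le_mul hcard hle hδ (by linarith)
    have h3 : ((F ∩ I.ordersOf (B :: P).flatten).card : ℝ) ≤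
        (F ∩ I.ordersOf B).card + (F ∩ I.ordersOf P.flatten).card := by
      have : F ∩ I.ordersOf (B :: P).flatten =
          (F ∩ I.ordersOf B) ∪ (F ∩ I.ordersOf P.flatten) := by
        rw [← Finset.inter_union_distrib_left]
        congr 1
        simp [ordersOf]
      rw [this]
      exact_mod_cast Finset.card_union_le _ _
    have h4 := mul_le_mul_of_nonneg_left h3 hδ
    linarith

lemma Feasible.far_card_mul_le {Q : I.Plan} (hQ : I.Feasible I.init Finset.univ Q)
    (sys : PickingSystem) {δ : ℝ} (hδ : 0 ≤ δ) (F : Finset (Fin I.n))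
    (hF : ∀ j ∈ F, Far sys δ (I.order j)) :
    δ * F.card ≤ w.c * completion sys w.depot 0 (I.actions Q) := by
  have hall : ∀ x : I.Item, x ∈ Q.flatten := fun x => (hQ.complete x).2 (by simp [init])
  have h1 := far_card_mul_le_walk sys hδ F hF Q w.depot (fun _ => rfl)
    (fun B hB x hx y e => hQ.unsplit B hB x hx y (hall y) e) (fun B hB => hQ.capacity hB)
  have h2 : F ∩ I.ordersOf Q.flatten = F := by
    refine Finset.inter_eq_left.2 fun j _ => mem_ordersOf.2 ⟨⟨j, ⟨0, (I.order j).2.1⟩⟩, hall _, rfl⟩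
  rw [h2] at h1
  have h3 := add_walk_le_completion sys w.depot 0 (I.actions Q)
  rw [zero_add] at h3
  exact h1.trans (mul_le_mul_of_nonneg_left h3 (by positivity))

/-! ### The optimality ratio -/

lemma bddBelow_completion (sys : PickingSystem) :
    BddBelow {v | ∃ P : I.Plan, I.Feasible I.init Finset.univ P ∧
      v = completion sys w.depot 0 (I.actions P)} :=
  ⟨0, by rintro v ⟨P, -, rfl⟩; exact le_completion _ _ _ _⟩

/-- Deterministic bounds for the optimality ratio. -/
theorem IsReoptResult.ratio_bounds {sys : PickingSystem} {V : ℝ} (h : I.IsReoptResult V sys)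
    (hmono : Monotone I.arrival) (h0 : ∀ j, 0 < I.arrival j) {t : ℝ}
    (ht : ∀ j, I.arrival j ≤ t) :
    1 ≤ I.ratio sys V ∧ I.ratio sys V ≤ 5 ∧
    (sys ≠ .robot → (∀ x, I.loc x = w.depot) → I.ratio sys V = 1) ∧
    ∀ {δ : ℝ}, 0 < δ → ∀ F : Finset (Fin I.n), F.Nonempty → (∀ j ∈ F, Far sys δ (I.order j)) →
      I.ratio sys V ≤ 1 + w.c * (t + (w.tourBound + w.diam)) / (δ * F.card) := by
  rcases Nat.eq_zero_or_pos I.n with hn | hn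
  · have hr : I.ratio sys V = 1 := if_pos hn
    rw [hr]
    refine ⟨le_rfl, by norm_num, fun _ _ => rfl, fun {δ} _ F hF => ?_⟩
    obtain ⟨j, -⟩ := hF
    exact absurd j.2 (by omega)
  have hr : I.ratio sys V = V / I.CIOPT sys := if_neg hn.ne'
  have hall := h.comparesToPlans hn hmono fun j => (h0 j).le
  obtain ⟨Q₀, hQ₀, hle⟩ := hall.exists_le
  have hne : {v | ∃ P : I.Plan, I.Feasible I.init Finset.univ P ∧
      v = completion sys w.depot 0 (I.actions P)}.Nonempty := ⟨_, Q₀, hQ₀, rfl⟩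
  have hge : ∀ r, (∀ Q : I.Plan, I.Feasible I.init Finset.univ Q →
      r ≤ completion sys w.depot 0 (I.actions Q)) → r ≤ I.CIOPT sys := by
    intro r hr
    refine le_csInf hne ?_
    rintro v ⟨Q, hQ, rfl⟩
    exact hr Q hQ
  -- Strict positivity of the arrival times keeps the denominator away from 0 even if nobody has to
  -- walk.
  have hpos : 0 < I.CIOPT sys :=
    (h0 ⟨0, hn⟩).trans_le (hge _ fun Q hQ => hQ.arrival_le_completion sys _)
  have hV : I.CIOPT sys ≤ V :=
    (csInf_le (bddBelow_completion sys) ⟨Q₀, hQ₀, rfl⟩).trans hle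
  have h1 : 1 ≤ I.ratio sys V := by rw [hr, le_div_iff₀ hpos]; linarith
  refine ⟨h1, ?_, fun hs hloc => le_antisymm ?_ h1, fun {δ} hδ F hFne hF => ?_⟩
  · rw [hr, div_le_iff₀ hpos]
    have := hge (V / 5) fun Q hQ => by linarith [hall.le_mul Q hQ]
    linarith
  · rw [hr, div_le_iff₀ hpos, one_mul]
    exact hge V fun Q hQ => hall.le_of_depot Q hQ hs hloc
  · have hK : V - (t + (w.tourBound + w.diam)) ≤ I.CIOPT sys :=
      hge _ fun Q hQ => by linarith [hall.le_add Q hQ t ht]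
    have hc : (0 : ℝ) < w.c := by exact_mod_cast w.one_le_c
    have hF' : 0 < δ * F.card := mul_pos hδ (by exact_mod_cast hFne.card_pos)
    have hfar : δ * F.card / w.c ≤ I.CIOPT sys :=
      hge _ fun Q hQ => by
        rw [div_le_iff₀ hc, mul_comm _ (w.c : ℝ)]
        exact hQ.far_card_mul_le sys hδ.le F hF
    have hK0 : 0 ≤ t + (w.tourBound + w.diam) := by
      have := diam_nonneg (w := w)
      have := w.W_pos
      have : 0 ≤ w.tourBound := by unfold tourBound; positivity
      have := (h0 ⟨0, hn⟩).le.trans (ht ⟨0, hn⟩)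
      positivity
    have h2 : (t + (w.tourBound + w.diam)) / I.CIOPT sys ≤
        w.c * (t + (w.tourBound + w.diam)) / (δ * F.card) := by
      rw [div_le_div_iff₀ hpos hF']
      rw [div_le_iff₀ hc] at hfar
      nlinarith [mul_le_mul_of_nonneg_left hfar hK0]
    have h3 : V / I.CIOPT sys ≤ 1 + (t + (w.tourBound + w.diam)) / I.CIOPT sys := by
      rw [one_add_div hpos.ne']
      gcongr
      linarith
    rw [hr]
    linarith

end Instance

end OOBSRP

end

noncomputable section

namespace OOBSRP

variable {w : Warehouse}

open Warehouse Instance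

/-! ### Arrival times -/

lemma strictMono_arrivalTime {X : ℕ → ℝ} (hX : ∀ j, 0 < X j) : StrictMono (arrivalTime X) :=
  strictMono_nat_of_lt_succ fun j => by
    unfold arrivalTime
    rw [Finset.sum_range_succ _ (j + 1)]
    linarith [hX (j + 1)]

lemma arrivalTime_pos {X : ℕ → ℝ} (hX : ∀ j, 0 < X j) (j : ℕ) : 0 < arrivalTime X j :=
  Finset.sum_pos (fun i _ => hX i) (by simp)

lemma arrivalTime_le_of_lt_numArrivals {X : ℕ → ℝ} (hX : ∀ j, 0 < X j) {t : ℝ} {j : ℕ}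
    (hj : j < numArrivals X t) : arrivalTime X j ≤ t := by
  by_contra hc
  have hsub : {k : ℕ | arrivalTime X k ≤ t} ⊆ (Finset.range j : Set ℕ) := by
    intro k hk
    rw [Finset.coe_range, Set.mem_Iio]
    by_contra hkj
    exact hc (((strictMono_arrivalTime hX).monotone (not_lt.1 hkj)).trans hk)
  have := Set.ncard_le_ncard hsub (Finset.finite_toSet _)
  rw [Set.ncard_coe_finset, Finset.card_range] at this
  exact absurd hj (not_lt.2 this)

/-- `Set.ncard` is 0 for an infinite set, so the hypothesis `numArrivals X t ≠ 0` excludes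
infinitely many arrivals in the window. -/
lemma lt_numArrivals_of_arrivalTime_le {X : ℕ → ℝ} (hX : ∀ j, 0 < X j) {t : ℝ} {j : ℕ}
    (hj : arrivalTime X j ≤ t) (hn : numArrivals X t ≠ 0) : j < numArrivals X t := by
  have hfin := Set.finite_of_ncard_ne_zero hn
  have hsub : (Finset.range (j + 1) : Set ℕ) ⊆ {k : ℕ | arrivalTime X k ≤ t} := by
    intro k hk
    rw [Finset.coe_range, Set.mem_Iio] at hk
    exact ((strictMono_arrivalTime hX).monotone (Nat.lt_succ_iff.1 hk)).trans hj
  have := Set.ncard_le_ncard hsub hfin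
  rwa [Set.ncard_coe_finset, Finset.card_range] at this

/-- The bounds for the optimality ratio on the orders that arrive in `[0, t]`. -/
lemma ratio_windowInstance_bounds {X : ℕ → ℝ} (hX : ∀ j, 0 < X j) {O : ℕ → w.CustomerOrder}
    {t : ℝ} {sys : PickingSystem} {V : ℝ} (h : (windowInstance X O t).IsReoptResult V sys) :
    1 ≤ (windowInstance X O t).ratio sys V ∧ (windowInstance X O t).ratio sys V ≤ 5 ∧
    (sys ≠ .robot → (∀ j i, (O j).1.2 i = w.depot) → (windowInstance X O t).ratio sys V = 1) ∧
    ∀ {δ : ℝ}, 0 < δ → ∀ m M : ℕ, 0 < M → arrivalTime X m ≤ t →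
      M ≤ {j ∈ (Finset.range m : Set ℕ) | Far sys δ (O j)}.ncard →
      (windowInstance X O t).ratio sys V ≤
        1 + w.c * (t + (w.tourBound + w.diam)) / (δ * M) := by
  have hmono : Monotone (windowInstance X O t).arrival := fun i j hij =>
    (strictMono_arrivalTime hX).monotone hij
  have ht : ∀ j, (windowInstance X O t).arrival j ≤ t := fun j =>
    arrivalTime_le_of_lt_numArrivals hX j.2
  obtain ⟨h1, h2, h3, h4⟩ := h.ratio_bounds hmono (fun j => arrivalTime_pos hX j) ht
  refine ⟨h1, h2, fun hs ho => h3 hs fun x => ho _ _, fun {δ} hδ m M hM hm hcount => ?_⟩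
  have ht0 : 0 < t := (arrivalTime_pos hX m).trans_le hm
  have hK : 0 ≤ w.c * (t + (w.tourBound + w.diam)) := by
    have := diam_nonneg (w := w)
    have := w.W_pos
    have : 0 ≤ w.tourBound := by unfold tourBound; positivity
    positivity
  -- This also covers infinitely many arrivals, where the count defaults to 0 and the ratio is 1 by
  -- convention.
  by_cases hn : numArrivals X t = 0
  · have : (windowInstance X O t).ratio sys V = 1 := if_pos hn
    rw [this]
    have : 0 ≤ w.c * (t + (w.tourBound + w.diam)) / (δ * M) := by positivity
    linarith
  · classical
    have hmn := lt_numArrivals_of_arrivalTime_le hX hm hn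
    let F : Finset (Fin (windowInstance X O t).n) := Finset.univ.filter fun j =>
      Far sys δ ((windowInstance X O t).order j)
    have hMF : M ≤ F.card := by
      refine hcount.trans ?_
      rw [← Finset.card_image_of_injective F Fin.val_injective, ← Set.ncard_coe_finset]
      refine Set.ncard_le_ncard ?_ (Finset.finite_toSet _)
      rintro j ⟨hj, hfar⟩
      rw [Finset.coe_range, Set.mem_Iio] at hj
      exact Finset.mem_coe.2 (Finset.mem_image.2
        ⟨⟨j, hj.trans hmn⟩, Finset.mem_filter.2 ⟨Finset.mem_univ _, hfar⟩, rfl⟩)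
    refine (h4 hδ F (Finset.card_pos.1 (hM.trans_le hMF))
      fun j hj => (Finset.mem_filter.1 hj).2).trans ?_
    have hM' : (0 : ℝ) < M := by exact_mod_cast hM
    gcongr

/-! ### Far orders have positive probability -/

lemma measurable_rect : Measurable fun z : w.Pt × w.Pt => rect z.1 z.2 := by
  unfold rect
  fun_prop

lemma measurableSet_far (sys : PickingSystem) (δ : ℝ) :
    MeasurableSet {o : w.CustomerOrder | Far sys δ o} := by
  have hrobot : MeasurableSet {o : Σ k : ℕ, (Fin k → w.Pt) | ∃ i j, δ ≤ rect (o.2 i) (o.2 j)} := by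
    -- The σ-algebra of a sigma type is an infimum over the summands, so measurability is checked
    -- for each number of items.
    refine MeasurableSpace.measurableSet_iInf.2 fun k => ?_
    change MeasurableSet {f : Fin k → w.Pt | ∃ i j, δ ≤ rect (f i) (f j)}
    simp only [Set.ofPred_exists]
    refine MeasurableSet.iUnion fun i => MeasurableSet.iUnion fun j =>
      measurableSet_le measurable_const ?_
    exact measurable_rect.comp (g := fun z : w.Pt × w.Pt => rect z.1 z.2)
      (f := fun f : Fin k → w.Pt => (f i, f j))
      ((measurable_pi_apply i).prodMk (measurable_pi_apply j))
  have hcart : MeasurableSet {o : Σ k : ℕ, (Fin k → w.Pt) | ∃ i, δ ≤ rect w.depot (o.2 i)} := by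
    refine MeasurableSpace.measurableSet_iInf.2 fun k => ?_
    change MeasurableSet {f : Fin k → w.Pt | ∃ i, δ ≤ rect w.depot (f i)}
    simp only [Set.ofPred_exists]
    refine MeasurableSet.iUnion fun i => measurableSet_le measurable_const ?_
    exact measurable_rect.comp (measurable_const.prodMk (measurable_pi_apply i))
  cases sys with
  | robot => exact measurable_subtype_coe hrobot
  | _ => exact measurable_subtype_coe hcart

/-- If `1/(m+1)`-far orders are null for every `m`, the relevant distances vanish almost surely. For
a pushcart all items are then at the depot. For a robot all items of an order coincide; they are
distinct, so there is only one, against the mean size being greater than 1. -/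
lemma exists_far_or_ae_depot (sys : PickingSystem) (ν : Measure w.CustomerOrder)
    [IsProbabilityMeasure ν]
    (hν : sys = .robot → 1 < ∫⁻ o, (Warehouse.CustomerOrder.size o : ℝ≥0∞) ∂ν) :
    (∃ δ : ℝ, 0 < δ ∧ ν {o | Far sys δ o} ≠ 0) ∨
      (sys ≠ .robot ∧ ∀ᵐ o ∂ν, ∀ i, o.1.2 i = w.depot) := by
  refine or_iff_not_imp_left.2 fun hfar => ?_
  push Not at hfar
  have hae : ∀ᵐ o ∂ν, ∀ m : ℕ, ¬ Far sys (1 / ((m : ℝ) + 1)) o :=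
    ae_all_iff.2 fun m => by
      have := hfar (1 / ((m : ℝ) + 1)) (by positivity)
      simpa [ae_iff] using this
  have hzero : ∀ p q : w.Pt, (∀ m : ℕ, ¬ 1 / ((m : ℝ) + 1) ≤ rect p q) → p = q := by
    intro p q h
    refine eq_of_rect_eq_zero ((rect_nonneg p q).antisymm' ?_)
    by_contra hpos
    obtain ⟨m, hm⟩ := exists_nat_one_div_lt (not_le.1 hpos)
    exact h m hm.le
  by_cases hs : sys = .robot
  · subst hs
    have hle : ∀ᵐ o ∂ν, (Warehouse.CustomerOrder.size o : ℝ≥0∞) ≤ 1 := by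
      filter_upwards [hae] with o ho
      have hsub : ∀ i j : Fin o.1.1, i = j := fun i j =>
        o.2.2.1 (hzero _ _ fun m hm => ho m ⟨i, j, hm⟩)
      have : Subsingleton (Fin o.1.1) := ⟨hsub⟩
      have : o.1.1 ≤ 1 := by simpa using Fintype.card_le_one_iff_subsingleton.2 this
      exact_mod_cast this
    have := lintegral_mono_ae hle
    rw [lintegral_one, measure_univ] at this
    exact absurd (hν rfl) (not_lt.2 this)
  · refine ⟨hs, ?_⟩
    filter_upwards [hae] with o ho i
    refine (hzero _ _ fun m hm => ho m ?_).symm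
    cases sys with
    | robot => exact absurd rfl hs
    | _ => exact ⟨i, hm⟩

/-! ### Many orders arrive, many of them far -/

section Model

variable {Ω : Type*} [MeasurableSpace Ω] {P : Measure Ω} {lam : ℝ}
  {ν : Measure w.CustomerOrder} {X : ℕ → Ω → ℝ} {O : ℕ → Ω → w.CustomerOrder}

lemma expMeasure_Ioi {r : ℝ} (hr : 0 < r) {s : ℝ} (hs : 0 ≤ s) :
    expMeasure r (Set.Ioi s) = ENNReal.ofReal (Real.exp (-(r * s))) := by
  have := isProbabilityMeasure_expMeasure hr
  have h1 : (expMeasure r).real (Set.Iic s) = 1 - Real.exp (-(r * s)) := by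
    rw [← cdf_eq_real, cdf_expMeasure_eq hr, if_pos hs]
  rw [← Set.compl_Iic, ← ofReal_measureReal, probReal_compl_eq_one_sub measurableSet_Iic, h1]
  simp

lemma PoissonModel.measure_lt (h : PoissonModel P lam ν X O) (hlam : 0 < lam) (j : ℕ) {s : ℝ}
    (hs : 0 ≤ s) : P {ω | s < X j ω} = ENNReal.ofReal (Real.exp (-(lam * s))) := by
  rw [← expMeasure_Ioi hlam hs, ← h.law_X j, Measure.map_apply (h.measurable_X j) measurableSet_Ioi]
  rfl

lemma PoissonModel.ae_pos [IsProbabilityMeasure P] (h : PoissonModel P lam ν X O) (hlam : 0 < lam) :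
    ∀ᵐ ω ∂P, ∀ j, 0 < X j ω := by
  refine ae_all_iff.2 fun j => ?_
  have h1 := h.measure_lt hlam j le_rfl
  rw [mul_zero, neg_zero, Real.exp_zero, ENNReal.ofReal_one] at h1
  rwa [← prob_compl_eq_zero_iff (measurableSet_lt measurable_const (h.measurable_X j))] at h1

/-- If a sum of `m + 1` interarrival times exceeds `t`, one of them exceeds `t / (m + 1)`. The union
bound suffices, because `m` stays fixed while the rate grows. -/
lemma PoissonModel.measure_lt_arrivalTime_le (h : PoissonModel P lam ν X O) (hlam : 0 < lam)
    {t : ℝ} (ht : 0 < t) (m : ℕ) :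
    P {ω | t < arrivalTime (fun j => X j ω) m} ≤
      (m + 1 : ℕ) * ENNReal.ofReal (Real.exp (-(lam * (t / (m + 1 : ℕ))))) := by
  have hsub : {ω | t < arrivalTime (fun j => X j ω) m} ⊆
      ⋃ j ∈ Finset.range (m + 1), {ω | t / (m + 1 : ℕ) < X j ω} := by
    intro ω hω
    by_contra hc
    simp only [Set.mem_iUnion, Set.mem_ofPred_eq, not_exists, not_lt] at hc
    have h1 := Finset.sum_le_card_nsmul (Finset.range (m + 1)) (fun j => X j ω) _ hc
    rw [Finset.card_range, nsmul_eq_mul, mul_div_cancel₀ _ (by positivity)] at h1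
    exact absurd hω (not_lt.2 h1)
  refine (measure_mono hsub).trans ((measure_biUnion_finset_le _ _).trans ?_)
  rw [Finset.sum_congr rfl fun j _ => h.measure_lt hlam j (by positivity)]
  simp

/-- Cut the first `M * q` orders into `M` blocks of length `q`. If every block meets `A`, there are
at least `M` hits; by independence a given block misses `A` with probability `ν Aᶜ ^ q`. -/
lemma PoissonModel.measure_few_le (h : PoissonModel P lam ν X O) {A : Set w.CustomerOrder}
    (hA : MeasurableSet A) (M q : ℕ) :
    P {ω | {j ∈ (Finset.range (M * q) : Set ℕ) | O j ω ∈ A}.ncard < M} ≤ M * ν Aᶜ ^ q := by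
  have hsub : {ω | {j ∈ (Finset.range (M * q) : Set ℕ) | O j ω ∈ A}.ncard < M} ⊆
      ⋃ b ∈ Finset.range M, ⋂ j ∈ Finset.Ico (b * q) (b * q + q), O j ⁻¹' Aᶜ := by
    intro ω hω
    by_contra hc
    simp only [Set.mem_iUnion, Set.mem_iInter, Set.mem_preimage, Set.mem_compl_iff, not_exists,
      not_forall, not_not, Finset.mem_range, Finset.mem_Ico] at hc
    choose! f hf hfA using hc
    have hinj : Set.InjOn f (Finset.range M : Set ℕ) := by
      intro b hb b' hb' e
      have hb := hf b (by simpa using hb)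
      have hb' := hf b' (by simpa using hb')
      rw [← e] at hb'
      by_contra hne
      rcases Nat.lt_or_gt_of_ne hne with hlt | hlt
      · have := Nat.mul_le_mul_right q hlt
        rw [Nat.succ_mul] at this
        omega
      · have := Nat.mul_le_mul_right q hlt
        rw [Nat.succ_mul] at this
        omega
    have hsub : f '' (Finset.range M : Set ℕ) ⊆
        {j ∈ (Finset.range (M * q) : Set ℕ) | O j ω ∈ A} := by
      rintro _ ⟨b, hb, rfl⟩
      have hb : b < M := by simpa using hb
      refine ⟨?_, hfA b hb⟩
      have h1 := Nat.mul_le_mul_right q (Nat.succ_le_of_lt hb)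
      rw [Nat.succ_mul] at h1
      have h2 := (hf b hb).2
      simp only [Finset.coe_range, Set.mem_Iio]
      omega
    have := Set.ncard_le_ncard hsub ((Finset.finite_toSet _).subset (Set.sep_subset _ _))
    rw [hinj.ncard_image, Set.ncard_coe_finset, Finset.card_range] at this
    exact absurd hω (not_lt.2 this)
  refine (measure_mono hsub).trans ((measure_biUnion_finset_le _ _).trans ?_)
  have hb : ∀ b, P (⋂ j ∈ Finset.Ico (b * q) (b * q + q), O j ⁻¹' Aᶜ) = ν Aᶜ ^ q := by
    intro b
    rw [h.indep_O.measure_inter_preimage_eq_mul _ (sets := fun _ => Aᶜ) fun _ _ => hA.compl,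
      Finset.prod_congr rfl fun j _ => by
        rw [← Measure.map_apply (h.measurable_O j) hA.compl, h.law_O j]]
    simp
  simp only [hb, Finset.sum_const, Finset.card_range, nsmul_eq_mul, le_refl]

end Model

/-! ### Random variables with values in a bounded interval -/

/-- Splitting at `a + ε` bounds the integral by `a + ε` plus `|C - a|` times a vanishing
probability. The probability spaces vary with `i`. -/
lemma tendsto_integral_of_tendsto_measure {Ω : ℕ → Type*} [∀ i, MeasurableSpace (Ω i)]
    (P : ∀ i, Measure (Ω i)) [∀ i, IsProbabilityMeasure (P i)] {f : ∀ i, Ω i → ℝ} {a C : ℝ}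
    (hf : ∀ i, Integrable (f i) (P i)) (hlow : ∀ i, ∀ᵐ ω ∂P i, a ≤ f i ω)
    (hup : ∀ i, ∀ᵐ ω ∂P i, f i ω ≤ C)
    (h : ∀ ε : ℝ, 0 < ε → Tendsto (fun i => P i {ω | a + ε ≤ f i ω}) atTop (𝓝 0)) :
    Tendsto (fun i => ∫ ω, f i ω ∂P i) atTop (𝓝 a) := by
  have hge : ∀ i, a ≤ ∫ ω, f i ω ∂P i := fun i => by
    simpa using integral_mono_ae (integrable_const a) (hf i) (hlow i)
  have hle : ∀ i (ε : ℝ), 0 < ε →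
      ∫ ω, f i ω ∂P i ≤ a + ε + |C - a| * (P i {ω | a + ε ≤ f i ω}).toReal := by
    intro i ε hε
    -- The set need not be measurable; its measurable hull has the same measure.
    let S := toMeasurable (P i) {ω | a + ε ≤ f i ω}
    have hS : MeasurableSet S := measurableSet_toMeasurable _ _
    have hint : Integrable (S.indicator fun _ => |C - a|) (P i) :=
      (integrable_const _).indicator hS
    have h1 : ∫ ω, f i ω ∂P i ≤ ∫ ω, ((a + ε) + S.indicator (fun _ => |C - a|) ω) ∂P i := by
      refine integral_mono_ae (hf i) ((integrable_const _).add hint) ?_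
      filter_upwards [hup i] with ω hω
      by_cases hmem : ω ∈ S
      · simp only [Set.indicator_of_mem hmem]
        linarith [le_abs_self (C - a)]
      · simp only [Set.indicator_of_notMem hmem, add_zero]
        exact (not_le.1 fun hc => hmem (subset_toMeasurable _ _ hc)).le
    rw [integral_add (integrable_const _) hint, integral_indicator_const _ hS] at h1
    simp only [integral_const, probReal_univ, smul_eq_mul, one_mul] at h1
    rw [measureReal_def, measure_toMeasurable] at h1
    linarith
  refine Metric.tendsto_atTop.2 fun ε hε => ?_
  have h1 : Tendsto (fun i => |C - a| * (P i {ω | a + ε / 2 ≤ f i ω}).toReal) atTop (𝓝 0) := by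
    have := (ENNReal.tendsto_toReal ENNReal.zero_ne_top).comp (h (ε / 2) (by positivity))
    simpa using this.const_mul |C - a|
  obtain ⟨N, hN⟩ := eventually_atTop.1 (h1.eventually_lt_const (half_pos hε))
  refine ⟨N, fun i hi => ?_⟩
  rw [Real.dist_eq, abs_of_nonneg (by linarith [hge i])]
  linarith [hle i (ε / 2) (by positivity), hN i hi]

end OOBSRP

end

/-! ### The limit theorem -/

theorem theorem3 (w : OOBSRP.Warehouse) (sys : OOBSRP.PickingSystem)
    (ν : Measure w.CustomerOrder) [IsProbabilityMeasure ν]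
    (hν : sys = OOBSRP.PickingSystem.robot →
      1 < ∫⁻ o, (OOBSRP.Warehouse.CustomerOrder.size o : ℝ≥0∞) ∂ν)
    (t : ℝ) (ht : 0 < t)
    (lam : ℕ → ℝ) (hlam_pos : ∀ i, 0 < lam i) (hlam_mono : Monotone lam)
    (hlam : Tendsto lam atTop atTop)
    {Ω : ℕ → Type*} [∀ i, MeasurableSpace (Ω i)]
    (P : ∀ i, Measure (Ω i)) [∀ i, IsProbabilityMeasure (P i)]
    (X : ∀ i, ℕ → Ω i → ℝ) (O : ∀ i, ℕ → Ω i → w.CustomerOrder)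
    (hmodel : ∀ i, OOBSRP.PoissonModel (P i) (lam i) ν (X i) (O i))
    (Reopt : ∀ i, Ω i → ℝ)
    (hReopt : ∀ i, ∀ᵐ ω ∂P i,
      (OOBSRP.randomInstance (X i) (O i) t ω).IsReoptResult (Reopt i ω) sys)
    (hmeas : ∀ i, AEMeasurable
      (fun ω => (OOBSRP.randomInstance (X i) (O i) t ω).ratio sys (Reopt i ω)) (P i)) :
    (∀ i, Integrable
      (fun ω => (OOBSRP.randomInstance (X i) (O i) t ω).ratio sys (Reopt i ω)) (P i)) ∧
    Tendsto (fun i => ∫ ω, (OOBSRP.randomInstance (X i) (O i) t ω).ratio sys (Reopt i ω) ∂P i)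
      atTop (𝓝 1) ∧
    ∀ ε : ℝ, 0 < ε →
      Tendsto
        (fun i => P i {ω | 1 + ε ≤ (OOBSRP.randomInstance (X i) (O i) t ω).ratio sys (Reopt i ω)})
        atTop (𝓝 0) := by
  have hpos : ∀ i, ∀ᵐ ω ∂P i, ∀ j, 0 < X i j ω := fun i => (hmodel i).ae_pos (hlam_pos i)
  have hbound : ∀ i, ∀ᵐ ω ∂P i,
      1 ≤ (OOBSRP.randomInstance (X i) (O i) t ω).ratio sys (Reopt i ω) ∧
      (OOBSRP.randomInstance (X i) (O i) t ω).ratio sys (Reopt i ω) ≤ 5 := fun i => by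
    filter_upwards [hpos i, hReopt i] with ω hX hr
    have := OOBSRP.ratio_windowInstance_bounds hX hr
    exact ⟨this.1, this.2.1⟩
  have hint : ∀ i, Integrable
      (fun ω => (OOBSRP.randomInstance (X i) (O i) t ω).ratio sys (Reopt i ω)) (P i) := fun i =>
    Integrable.of_mem_Icc 1 5 (hmeas i) (hbound i)
  suffices hprob : ∀ ε : ℝ, 0 < ε → Tendsto
      (fun i => P i {ω | 1 + ε ≤ (OOBSRP.randomInstance (X i) (O i) t ω).ratio sys (Reopt i ω)})
      atTop (𝓝 0) from
    ⟨hint, OOBSRP.tendsto_integral_of_tendsto_measure P hint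
      (fun i => (hbound i).mono fun _ h => h.1) (fun i => (hbound i).mono fun _ h => h.2) hprob,
      hprob⟩
  intro ε hε
  rcases OOBSRP.exists_far_or_ae_depot sys ν hν with ⟨δ, hδ, hfar⟩ | ⟨hs, hdep⟩
  -- With `M + 1` far orders the deterministic bound is less than `1 + ε`; the extra 1 makes the
  -- number positive.
  · obtain ⟨M, hM⟩ := exists_nat_gt (w.c * (t + (w.tourBound + w.diam)) / (δ * ε))
    have hM' : w.c * (t + (w.tourBound + w.diam)) / (δ * (M + 1 : ℕ)) < ε := by
      rw [div_lt_iff₀ (by positivity)] at hM ⊢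
      push_cast
      nlinarith [mul_pos hδ hε]
    have hA := OOBSRP.measurableSet_far (w := w) sys δ
    have hlt : ν {o | OOBSRP.Instance.Far sys δ o}ᶜ < 1 := by
      rw [prob_compl_eq_one_sub hA]
      exact ENNReal.sub_lt_self ENNReal.one_ne_top one_ne_zero hfar
    refine ENNReal.tendsto_nhds_zero.2 fun η hη => ?_
    have hη2 : 0 < η / 2 := ENNReal.half_pos hη.ne'
    have hq : Tendsto (fun q : ℕ => ((M + 1 : ℕ) : ℝ≥0∞) *
        ν {o | OOBSRP.Instance.Far sys δ o}ᶜ ^ q) atTop (𝓝 0) := by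
      simpa using ENNReal.Tendsto.const_mul (ENNReal.tendsto_pow_atTop_nhds_zero_of_lt_one hlt)
        (Or.inr (ENNReal.natCast_ne_top (M + 1)))
    -- The block length is fixed before the rate: finding too few far orders among the first `(M +
    -- 1) * q` has a probability bound that does not involve the rate.
    obtain ⟨q, hq⟩ := (hq.eventually_le_const hη2).exists
    have hm : Tendsto (fun i => (((M + 1) * q + 1 : ℕ) : ℝ≥0∞) * ENNReal.ofReal
        (Real.exp (-(lam i * (t / ((M + 1) * q + 1 : ℕ)))))) atTop (𝓝 0) := by
      have h1 : Tendsto (fun i => Real.exp (-(lam i * (t / ((M + 1) * q + 1 : ℕ))))) atTop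
          (𝓝 0) :=
        Real.tendsto_exp_neg_atTop_nhds_zero.comp (hlam.atTop_mul_const (by positivity))
      simpa using ENNReal.Tendsto.const_mul (ENNReal.tendsto_ofReal h1)
        (Or.inr (ENNReal.natCast_ne_top ((M + 1) * q + 1)))
    filter_upwards [hm.eventually_le_const hη2] with i hi
    calc P i {ω | 1 + ε ≤ (OOBSRP.randomInstance (X i) (O i) t ω).ratio sys (Reopt i ω)}
        ≤ P i ({ω | t < OOBSRP.arrivalTime (fun j => X i j ω) ((M + 1) * q)} ∪
            {ω | {j ∈ (Finset.range ((M + 1) * q) : Set ℕ) |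
              O i j ω ∈ {o | OOBSRP.Instance.Far sys δ o}}.ncard < M + 1}) := by
          refine measure_mono_ae ?_
          filter_upwards [hpos i, hReopt i] with ω hX hr hω
          by_contra hc
          have hc := not_or.1 hc
          have := (OOBSRP.ratio_windowInstance_bounds hX hr).2.2.2 hδ ((M + 1) * q) (M + 1)
            (by omega) (not_lt.1 hc.1) (not_lt.1 hc.2)
          have hω : 1 + ε ≤ (OOBSRP.windowInstance (fun j => X i j ω) (fun j => O i j ω) t).ratio
            sys (Reopt i ω) := hω
          linarith
      _ ≤ η / 2 + η / 2 := (measure_union_le _ _).trans (add_le_add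
          (((hmodel i).measure_lt_arrivalTime_le (hlam_pos i) ht _).trans hi)
          (((hmodel i).measure_few_le hA (M + 1) q).trans hq))
      _ = η := ENNReal.add_halves η
  -- All items are almost surely at the depot, so the ratio is 1 and the event is null for every
  -- `i`.
  · refine tendsto_const_nhds.congr fun i => (measure_eq_zero_iff_ae_notMem.2 ?_).symm
    have hO : ∀ᵐ ω ∂P i, ∀ j, ∀ k, (O i j ω).1.2 k = w.depot :=
      ae_all_iff.2 fun j => by
        have h1 := (hmodel i).law_O j
        rw [← h1] at hdep
        exact ae_of_ae_map ((hmodel i).measurable_O j).aemeasurable hdep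
    filter_upwards [hpos i, hReopt i, hO] with ω hX hr hω hmem
    have h1 := (OOBSRP.ratio_windowInstance_bounds hX hr).2.2.1 hs hω
    have h2 : 1 + ε ≤ (OOBSRP.windowInstance (fun j => X i j ω) (fun j => O i j ω) t).ratio
      sys (Reopt i ω) := hmem
    linarith
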